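/- Let $\mathcal Z\subseteq\mathbb R^d$ be a closed convex set, let $c(z;y)$ be a real-valued cost function that is convex in $z\in\mathcal Z$ for every fixed $y$, let $y^1,\dots,y^N$ be data, and let $w_i=w_{N,i}(x)\ge 0$ be the weights at a fixed $x$. Put $N_0=\sum_{i=1}^N\mathbb I[w_i>0]$ (the effective sample size) and consider $$\min_{z\in\mathcal Z}F(z),\qquad F(z)=\sum_{i=1}^N w_i\,c(z;y^i).$$ Suppose that the following oracles are given: a separation oracle for $\mathcal Z$ (for a point $z$ it asserts that $z\in\mathcal Z$, or it returns a vector $a\ne 0$ with $\langle a,z'\rangle\le\langle a,z\rangle$ for all $z'\in\mathcal Z$), and, for $z\in\mathcal Z$, an evaluation oracle for $c(z;y)$ and a subgradient oracle (it returns some $s$ with $c(z';y)\ge c(z;y)+\langle s,z'-z\rangle$ for all $z'\in\mathcal Z$). As usual for the ellipsoid method, suppose also that numbers $R$, $r>0$, $V$ are given such that some minimizer of $F$ over $\mathcal Z$ has Euclidean norm at most $R$, the set $\mathcal Z_R=\{z\in\mathcal Z:\|z\|\le R\}$ contains a closed ball of radius $r$, and $F(z)-F(z')\le V$ for all $z,z'\in\mathcal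 Z_R$. Then an $\epsilon$-optimal solution, i.e. a point $\hat z\in\mathcal Z$ with $F(\hat z)\le F(z)+\epsilon$ for all $z\in\mathcal Z$, can be found in time and oracle calls polynomial in $N_0$, $d$, $\log(1/\epsilon)$ (and in the logarithms of $R/r$ and $V$). Precisely: there are one algorithm and constants $C,m$ such that, for every such problem and every $\epsilon>0$, the algorithm, given $d$, $N_0$, the positive weights, $\epsilon,R,r,V$ and access to the oracles (for the costs $c(\cdot;y^i)$ with $w_i>0$), halts with an $\epsilon$-optimal solution, and both its running time and its number of oracle calls are at most $$C\,\bigl(1+N_0+d+\log(2+R/r)+\log(2+V/\epsilon)\bigr)^m .$$ Algorithms are programs of a random access machine with exact real arithmetic: each addition, subtraction, multiplication, division, comparison, memory access and operation on natural-number registers takes one unit of time, and each oracle call takes $d+1$ units. No roots and no rounding of real numbers are available. -/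

import Mathlib

/-!
## Convex programming with oracles on a real-number random access machine

The machine has natural number registers (used for counting and for addressing), real
registers, and real arrays. Real arithmetic is exact and restricted to the field operations;
real numbers can be compared, but not rounded. Every elementary instruction and every test
costs one unit of time; a call of an oracle costs `d + 1` units, where `d` is the dimension
of the decision variable, and is also counted separately.
-/

namespace RealRAM

/-- The decision space `ℝ^d` with its Euclidean norm. -/
abbrev Vec (d : ℕ) : Type := EuclideanSpace ℝ (Fin d)

/-- The oracles to which a program has access: a separation oracle (`none` is the answer
"the point belongs to the set", `some a` is a separating vector), and evaluation and subgradient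
oracles for `n` functions, which are called by their number. -/
structure Oracles (d n : ℕ) where
  sep : Vec d → Option (Vec d)
  eval : Fin n → Vec d → ℝ
  subgrad : Fin n → Vec d → Vec d

/-- The memory of the machine. -/
structure State where
  int : ℕ → ℕ
  reg : ℕ → ℝ
  arr : ℕ → ℕ → ℝ

namespace State

/-- Assign `k` to the natural number register `i`. -/
def setInt (s : State) (i k : ℕ) : State :=
  { s with int := Function.update s.int i k }

/-- Assign `x` to the real register `i`. -/
def setReg (s : State) (i : ℕ) (x : ℝ) : State :=
  { s with reg := Function.update s.reg i x }

/-- Assign `x` to entry `k` of the real array `a`. -/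
def setEntry (s : State) (a k : ℕ) (x : ℝ) : State :=
  { s with arr := Function.update s.arr a (Function.update (s.arr a) k x) }

/-- The vector formed by the first `d` entries of the array `a`. -/
def readVec (s : State) (d a : ℕ) : Vec d :=
  WithLp.toLp 2 fun k : Fin d => s.arr a k

/-- Write the vector `v` into the first `d` entries of the array `a`. -/
def writeVec (s : State) {d : ℕ} (a : ℕ) (v : Vec d) : State :=
  { s with
    arr := Function.update s.arr a fun k => if h : k < d then v ⟨k, h⟩ else s.arr a k }

end State

/-- Elementary instructions. The arguments are numbers of registers and arrays, except for the
constant in `intConst`; the first argument is the target. -/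
inductive Instr where
  /-- `int i := k` -/
  | intConst (i k : ℕ)
  /-- `int i := int j + int k` -/
  | intAdd (i j k : ℕ)
  /-- `int i := int j - int k`, and `0` if this is negative -/
  | intSub (i j k : ℕ)
  /-- `int i := int j * int k` -/
  | intMul (i j k : ℕ)
  /-- `reg i := int j` -/
  | realOfInt (i j : ℕ)
  /-- `reg i := reg j + reg k` -/
  | add (i j k : ℕ)
  /-- `reg i := reg j - reg k` -/
  | sub (i j k : ℕ)
  /-- `reg i := reg j * reg k` -/
  | mul (i j k : ℕ)
  /-- `reg i := reg j / reg k`, and `0` if the denominator vanishes -/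
  | div (i j k : ℕ)
  /-- `reg i := arr a [int j]` -/
  | load (i a j : ℕ)
  /-- `arr a [int j] := reg i` -/
  | store (a j i : ℕ)
  /-- Call the separation oracle at the point in array `a`. Register `int f` becomes `1` if the
  point belongs to the set; otherwise it becomes `0` and the separating vector is written
  into array `b`. -/
  | callSep (f b a : ℕ)
  /-- `reg i :=` the value of function number `int j` at the point in array `a` -/
  | callEval (i j a : ℕ)
  /-- Write into array `b` the answer of the subgradient oracle for function number `int j` at
  the point in array `a`. -/
  | callSubgrad (b j a : ℕ)

namespace Instr

/-- The effect of an instruction. A call for a function number `≥ n` has no effect. -/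
noncomputable def exec {d n : ℕ} (O : Oracles d n) : Instr → State → State
  | intConst i k, s => s.setInt i k
  | intAdd i j k, s => s.setInt i (s.int j + s.int k)
  | intSub i j k, s => s.setInt i (s.int j - s.int k)
  | intMul i j k, s => s.setInt i (s.int j * s.int k)
  | realOfInt i j, s => s.setReg i (s.int j : ℝ)
  | add i j k, s => s.setReg i (s.reg j + s.reg k)
  | sub i j k, s => s.setReg i (s.reg j - s.reg k)
  | mul i j k, s => s.setReg i (s.reg j * s.reg k)
  | div i j k, s => s.setReg i (s.reg j / s.reg k)
  | load i a j, s => s.setReg i (s.arr a (s.int j))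
  | store a j i, s => s.setEntry a (s.int j) (s.reg i)
  | callSep f b a, s =>
      match O.sep (s.readVec d a) with
      | none => s.setInt f 1
      | some v => (s.setInt f 0).writeVec b v
  | callEval i j a, s =>
      if h : s.int j < n then s.setReg i (O.eval ⟨s.int j, h⟩ (s.readVec d a)) else s
  | callSubgrad b j a, s =>
      if h : s.int j < n then s.writeVec b (O.subgrad ⟨s.int j, h⟩ (s.readVec d a)) else s

/-- The number of oracle calls made by an instruction. -/
def calls : Instr → ℕ
  | callSep _ _ _ => 1
  | callEval _ _ _ => 1
  | callSubgrad _ _ _ => 1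
  | _ => 0

/-- The time needed by an instruction, in dimension `d`. -/
def time (d : ℕ) (I : Instr) : ℕ := 1 + I.calls * d

end Instr

/-- The tests of the machine: a comparison of two registers. -/
inductive Test where
  /-- `int i < int j` -/
  | intLt (i j : ℕ)
  /-- `reg i < reg j` -/
  | realLt (i j : ℕ)

/-- The test succeeds. -/
def Test.holds : Test → State → Prop
  | intLt i j, s => s.int i < s.int j
  | realLt i j, s => s.reg i < s.reg j

/-- Programs. -/
inductive Prog where
  | instr (I : Instr)
  | seq (P Q : Prog)
  /-- if `c` then `P` else `Q` -/
  | ite (c : Test) (P Q : Prog)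
  /-- while `c` do `P` -/
  | loop (c : Test) (P : Prog)

/-- `Exec O P s s' t q`: the program `P`, started in the state `s`, halts in the state `s'` after
time `t` and `q` oracle calls. -/
inductive Exec {d n : ℕ} (O : Oracles d n) : Prog → State → State → ℕ → ℕ → Prop where
  | instr (I : Instr) (s : State) :
      Exec O (.instr I) s (I.exec O s) (I.time d) I.calls
  | seq {P Q : Prog} {s s' s'' : State} {t t' q q' : ℕ} :
      Exec O P s s' t q → Exec O Q s' s'' t' q' → Exec O (.seq P Q) s s'' (t + t') (q + q')
  | iteTrue {c : Test} {P Q : Prog} {s s' : State} {t q : ℕ} :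
      c.holds s → Exec O P s s' t q → Exec O (.ite c P Q) s s' (1 + t) q
  | iteFalse {c : Test} {P Q : Prog} {s s' : State} {t q : ℕ} :
      ¬ c.holds s → Exec O Q s s' t q → Exec O (.ite c P Q) s s' (1 + t) q
  | loopStop {c : Test} {P : Prog} {s : State} :
      ¬ c.holds s → Exec O (.loop c P) s s 1 0
  | loopStep {c : Test} {P : Prog} {s s' s'' : State} {t t' q q' : ℕ} :
      c.holds s → Exec O P s s' t q → Exec O (.loop c P) s' s'' t' q' →
      Exec O (.loop c P) s s'' (1 + t + t') (q + q')

end RealRAM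

namespace PredictivePrescription

open RealRAM

/-- `sep` is a separation oracle for `Z`: it recognizes the members of `Z`, and for every other
point `z` it returns a nonzero vector `a` with `⟪a, z'⟫ ≤ ⟪a, z⟫` for all `z' ∈ Z`. -/
def IsSeparationOracle {d : ℕ} (Z : Set (Vec d)) (sep : Vec d → Option (Vec d)) : Prop :=
  ∀ z : Vec d, (z ∈ Z → sep z = none) ∧
    (z ∉ Z → ∃ a : Vec d, sep z = some a ∧ a ≠ 0 ∧ ∀ z' ∈ Z, inner ℝ a z' ≤ inner ℝ a z)

/-- `ev` is an evaluation oracle on `Z` for the cost function `c`. -/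
def IsEvaluationOracle {d : ℕ} {Y : Type*} (Z : Set (Vec d)) (c ev : Vec d → Y → ℝ) : Prop :=
  ∀ z ∈ Z, ∀ y, ev z y = c z y

/-- `sg` is a subgradient oracle on `Z` for the cost function `c` (in its first argument). -/
def IsSubgradientOracle {d : ℕ} {Y : Type*} (Z : Set (Vec d)) (c : Vec d → Y → ℝ)
    (sg : Vec d → Y → Vec d) : Prop :=
  ∀ z ∈ Z, ∀ y, ∀ z' ∈ Z, c z y + inner ℝ (sg z y) (z' - z) ≤ c z' y

/-- The weighted empirical cost `∑ i, w i * c(z; y i)`. -/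
noncomputable def objective {d N : ℕ} {Y : Type*} (c : Vec d → Y → ℝ) (y : Fin N → Y)
    (w : Fin N → ℝ) (z : Vec d) : ℝ :=
  ∑ i, w i * c z (y i)

/-- `z` is an `ε`-optimal solution of the problem of minimizing `F` over `Z`. -/
def IsEpsOptimal {d : ℕ} (Z : Set (Vec d)) (F : Vec d → ℝ) (ε : ℝ) (z : Vec d) : Prop :=
  z ∈ Z ∧ ∀ z' ∈ Z, F z ≤ F z' + ε

/-- The observations of positive weight. -/
noncomputable def active {N : ℕ} (w : Fin N → ℝ) : Finset (Fin N) :=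
  {i | 0 < w i}

/-- The effective sample size: the number of observations of positive weight. -/
noncomputable def effectiveSize {N : ℕ} (w : Fin N → ℝ) : ℕ :=
  (active w).card

/-- The observations of positive weight, listed in increasing order. -/
noncomputable def activeIndex {N : ℕ} (w : Fin N → ℝ) : Fin (effectiveSize w) → Fin N :=
  (active w).orderEmbOfFin rfl

/-- The oracles given to a program: function number `j` is the cost `c(·; y i)` of the `j`-th
observation `i` of positive weight. -/
noncomputable def oracles {d N : ℕ} {Y : Type*} (sep : Vec d → Option (Vec d))
    (ev : Vec d → Y → ℝ) (sg : Vec d → Y → Vec d) (y : Fin N → Y) (w : Fin N → ℝ) :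
    Oracles d (effectiveSize w) where
  sep := sep
  eval j z := ev z (y (activeIndex w j))
  subgrad j z := sg z (y (activeIndex w j))

/-- The initial state: the natural number registers `0` and `1` hold the dimension and the
effective sample size, the real registers `0`, `1`, `2`, `3` hold `ε`, `R`, `r`, `V`, array `0`
holds the positive weights, and everything else is `0`. -/
noncomputable def inputState {N : ℕ} (d : ℕ) (w : Fin N → ℝ) (ε R r V : ℝ) : State where
  int k := if k = 0 then d else if k = 1 then effectiveSize w else 0
  reg k := if k = 0 then ε else if k = 1 then R else if k = 2 then r else if k = 3 then V else 0
  arr a k := if h : a = 0 ∧ k < effectiveSize w then w (activeIndex w ⟨k, h.2⟩) else 0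

/-- The output of a program: the vector in array `1` of the final state. -/
noncomputable def output (d : ℕ) (s : State) : Vec d := s.readVec d 1

end PredictivePrescription

/-!
The method is the simplex-splitting method of Yamnitsky and Levin, a variant of the ellipsoid
method that needs only the field operations. The localizer is a simplex with vertices
`v 0, …, v d`, and the query point is its centroid `x`. A query yields a vector `g` such that every
feasible point `z` with `⟪g, z - x⟫ > 0` can be disregarded: if `x` is infeasible, `g` is the separating
vector, and otherwise `g` is a subgradient of the objective at `x`, so that such a `z` is not
better than `x`, which is recorded if it is the best point so far.

Let `v k` be the vertex with the smallest slope `h i = ⟪g, v i - x⟫`. Moving the other vertices on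
their edges through `v k`, so that the vector from `v k` to `v i` is divided by
`1 - h i / (8 * d ^ 2 * h k)`, gives a simplex that contains the remaining half of the old one
(`InSimplex.pullVertices`), and divides the volume by at least `exp (1 / (16 * d ^ 2))`
(`exp_le_prod`; both are combined in `simplex_round`).

The volume is measured by the determinant of the matrix with the rows `(1, v i)`. A homothety about
the minimizer maps the given ball of radius `r` onto a ball of `ε`-optimal points, of radius
`ρ = r / (1 + V / ε)`. Only the `d + 1` vertices of a right-angled simplex in this ball, with legs `ρ`,
are used (`isEpsOptimal_cornerSimplex`). As long as no `ε`-optimal point has been recorded, they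
all lie in the localizer, whence its determinant is at least `ρ ^ d` (`abs_det_vertexMatrix_le`,
because a row stochastic matrix has a determinant of absolute value at most `1`). The initial
simplex, which contains the ball of radius `R`, has determinant `(2 * d * R) ^ d`. So it suffices
to make `16 * d ^ 3 * (N + 1)` rounds, where `2 * d * R ≤ ρ * 2 ^ N`; the program finds `N` by
doubling. In dimension `0` no round is made, and every point is optimal.

The program is verified by rules of total correctness (`Runs`). The time bound `Prog.cost` and the
parts of the memory that a program leaves alone (`Unchanged`) are read off from the program text,
so that the specifications of the parts of the program state only what they compute.
-/

namespace RealRAM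

variable {d n : ℕ} {O : Oracles d n}

/-! ### Verification of programs -/

namespace Instr

/-- The instruction writes into the natural number register `i`. -/
def writesInt (i : ℕ) : Instr → Bool
  | intConst j _ => j == i
  | intAdd j _ _ => j == i
  | intSub j _ _ => j == i
  | intMul j _ _ => j == i
  | callSep f _ _ => f == i
  | _ => false

/-- The instruction writes into the real register `i`. -/
def writesReg (i : ℕ) : Instr → Bool
  | realOfInt j _ => j == i
  | add j _ _ => j == i
  | sub j _ _ => j == i
  | mul j _ _ => j == i
  | div j _ _ => j == i
  | load j _ _ => j == i
  | callEval j _ _ => j == i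
  | _ => false

/-- The instruction writes into the array `a`. -/
def writesArr (a : ℕ) : Instr → Bool
  | store b _ _ => b == a
  | callSep _ b _ => b == a
  | callSubgrad b _ _ => b == a
  | _ => false

theorem exec_int {i : ℕ} {I : Instr} (h : I.writesInt i = false) (s : State) :
    (I.exec O s).int i = s.int i := by
  cases I <;> simp only [writesInt, beq_eq_false_iff_ne, ne_eq] at h <;>
    simp only [exec, State.setInt, State.setReg, State.setEntry, State.writeVec] <;>
    (try split) <;> first | rfl | exact Function.update_of_ne (Ne.symm h) _ _

theorem exec_reg {i : ℕ} {I : Instr} (h : I.writesReg i = false) (s : State) :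
    (I.exec O s).reg i = s.reg i := by
  cases I <;> simp only [writesReg, beq_eq_false_iff_ne, ne_eq] at h <;>
    simp only [exec, State.setInt, State.setReg, State.setEntry, State.writeVec] <;>
    (try split) <;> first | rfl | exact Function.update_of_ne (Ne.symm h) _ _

theorem exec_arr {a : ℕ} {I : Instr} (h : I.writesArr a = false) (s : State) :
    (I.exec O s).arr a = s.arr a := by
  cases I <;> simp only [writesArr, beq_eq_false_iff_ne, ne_eq] at h <;>
    simp only [exec, State.setInt, State.setReg, State.setEntry, State.writeVec] <;>
    (try split) <;> first | rfl | exact Function.update_of_ne (Ne.symm h) _ _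

end Instr

namespace Prog

/-- Some instruction of the program writes into the natural number register `i`. -/
def writesInt (i : ℕ) : Prog → Bool
  | instr I => I.writesInt i
  | seq P Q => P.writesInt i || Q.writesInt i
  | ite _ P Q => P.writesInt i || Q.writesInt i
  | loop _ P => P.writesInt i

/-- Some instruction of the program writes into the real register `i`. -/
def writesReg (i : ℕ) : Prog → Bool
  | instr I => I.writesReg i
  | seq P Q => P.writesReg i || Q.writesReg i
  | ite _ P Q => P.writesReg i || Q.writesReg i
  | loop _ P => P.writesReg i

/-- Some instruction of the program writes into the array `a`. -/
def writesArr (a : ℕ) : Prog → Bool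
  | instr I => I.writesArr a
  | seq P Q => P.writesArr a || Q.writesArr a
  | ite _ P Q => P.writesArr a || Q.writesArr a
  | loop _ P => P.writesArr a

/-- A static bound on the running time in dimension `d`, when `B c` bounds the number of rounds of
every loop with test `c`. -/
def cost (d : ℕ) (B : Test → ℕ) : Prog → ℕ
  | instr I => I.time d
  | seq P Q => P.cost d B + Q.cost d B
  | ite _ P Q => 1 + (P.cost d B + Q.cost d B)
  | loop c P => B c * (P.cost d B + 1) + 1

/-- A measure for the length of a program: the constant factor in the bound of its running time. -/
def size : Prog → ℕ
  | instr _ => 1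
  | seq P Q => P.size + Q.size
  | ite _ P Q => 1 + (P.size + Q.size)
  | loop _ P => P.size + 2

/-- One more than the nesting depth of loops: the degree of the bound of the running time. -/
def depth : Prog → ℕ
  | instr _ => 1
  | seq P Q => max P.depth Q.depth
  | ite _ P Q => max P.depth Q.depth
  | loop _ P => P.depth + 1

/-- The running time is polynomial in the dimension and the numbers of rounds of the loops. -/
theorem cost_le {B : Test → ℕ} {X : ℕ} (hd : d + 1 ≤ X) (hB : ∀ c, B c ≤ X) (P : Prog) :
    P.cost d B ≤ P.size * X ^ P.depth := by
  have hX : 1 ≤ X := by omega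
  induction P with
  | instr I =>
    have : I.calls ≤ 1 := by cases I <;> simp [Instr.calls]
    simp only [cost, Instr.time, size, depth]
    nlinarith
  | seq P Q hP hQ =>
    have h1 := Nat.pow_le_pow_right hX (le_max_left P.depth Q.depth)
    have h2 := Nat.pow_le_pow_right hX (le_max_right P.depth Q.depth)
    simp only [cost, size, depth]
    nlinarith [Nat.mul_le_mul_left P.size h1, Nat.mul_le_mul_left Q.size h2]
  | ite c P Q hP hQ =>
    have h1 := Nat.pow_le_pow_right hX (le_max_left P.depth Q.depth)
    have h2 := Nat.pow_le_pow_right hX (le_max_right P.depth Q.depth)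
    have h3 : 1 ≤ X ^ max P.depth Q.depth := Nat.one_le_pow _ _ hX
    simp only [cost, size, depth]
    nlinarith [Nat.mul_le_mul_left P.size h1, Nat.mul_le_mul_left Q.size h2]
  | loop c P hP =>
    have h3 : 1 ≤ X ^ P.depth := Nat.one_le_pow _ _ hX
    simp only [cost, size, depth, pow_succ]
    calc B c * (P.cost d B + 1) + 1
        ≤ X * (P.size * X ^ P.depth + X ^ P.depth) + X ^ P.depth * X := by
          gcongr
          · exact hB c
          · exact Nat.one_le_iff_ne_zero.2 (by positivity)
      _ = (P.size + 2) * (X ^ P.depth * X) := by ring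

end Prog

/-- The parts of the memory into which `P` does not write agree in `s` and `s'`. -/
structure Unchanged (P : Prog) (s s' : State) : Prop where
  int : ∀ i, P.writesInt i = false → s'.int i = s.int i
  reg : ∀ i, P.writesReg i = false → s'.reg i = s.reg i
  arr : ∀ a, P.writesArr a = false → s'.arr a = s.arr a

theorem Unchanged.refl (P : Prog) (s : State) : Unchanged P s s :=
  ⟨fun _ _ => rfl, fun _ _ => rfl, fun _ _ => rfl⟩

theorem Unchanged.trans {P : Prog} {s s' s'' : State} (h : Unchanged P s s')
    (h' : Unchanged P s' s'') : Unchanged P s s'' :=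
  ⟨fun i hi => (h'.int i hi).trans (h.int i hi), fun i hi => (h'.reg i hi).trans (h.reg i hi),
    fun i hi => (h'.arr i hi).trans (h.arr i hi)⟩

theorem Unchanged.of_le {P Q : Prog} {s s' : State} (h : Unchanged P s s')
    (hi : ∀ i, Q.writesInt i = false → P.writesInt i = false)
    (hr : ∀ i, Q.writesReg i = false → P.writesReg i = false)
    (ha : ∀ i, Q.writesArr i = false → P.writesArr i = false) : Unchanged Q s s' :=
  ⟨fun i h' => h.int i (hi i h'), fun i h' => h.reg i (hr i h'), fun i h' => h.arr i (ha i h')⟩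

theorem Exec.unchanged {P : Prog} {s s' : State} {t q : ℕ} (h : Exec O P s s' t q) :
    Unchanged P s s' := by
  induction h with
  | instr I s => exact ⟨fun _ hi => Instr.exec_int hi s, fun _ hi => Instr.exec_reg hi s,
      fun _ hi => Instr.exec_arr hi s⟩
  | seq _ _ h h' =>
    refine (h.of_le ?_ ?_ ?_).trans (h'.of_le ?_ ?_ ?_) <;> intro i hi <;>
      simp_all [Prog.writesInt, Prog.writesReg, Prog.writesArr]
  | iteTrue _ _ h =>
    refine h.of_le ?_ ?_ ?_ <;> intro i hi <;>
      simp_all [Prog.writesInt, Prog.writesReg, Prog.writesArr]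
  | iteFalse _ _ h =>
    refine h.of_le ?_ ?_ ?_ <;> intro i hi <;>
      simp_all [Prog.writesInt, Prog.writesReg, Prog.writesArr]
  | loopStop _ => exact .refl _ _
  | loopStep _ _ _ h h' =>
    exact (h.of_le (Q := .loop _ _) (fun _ h => h) (fun _ h => h) (fun _ h => h)).trans h'

/-- Every oracle call takes at least one unit of time. -/
theorem Exec.calls_le_time {P : Prog} {s s' : State} {t q : ℕ} (h : Exec O P s s' t q) :
    q ≤ t := by
  induction h with
  | instr I s => cases I <;> simp [Instr.calls, Instr.time]
  | _ => omega

/-- Total correctness with a time bound: the program `P`, started in `s`, halts within its static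
time bound, in a state with the property `Q`. -/
def Runs (O : Oracles d n) (B : Test → ℕ) (P : Prog) (s : State) (Q : State → Prop) : Prop :=
  ∃ s' t q, Exec O P s s' t q ∧ t ≤ P.cost d B ∧ Q s'

section Rules

variable {B : Test → ℕ} {P P' : Prog} {s : State} {Q Q' : State → Prop}

theorem Runs.mono (h : Runs O B P s Q) (hQ : ∀ s', Unchanged P s s' → Q s' → Q' s') :
    Runs O B P s Q' := by
  obtain ⟨s', t, q, he, ht, h⟩ := h
  exact ⟨s', t, q, he, ht, hQ s' he.unchanged h⟩

theorem Runs.instr {I : Instr} (h : Q (I.exec O s)) : Runs O B (.instr I) s Q :=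
  ⟨_, _, _, .instr I s, le_rfl, h⟩

theorem Runs.seq (h : Runs O B P s Q) (h' : ∀ s', Unchanged P s s' → Q s' → Runs O B P' s' Q') :
    Runs O B (.seq P P') s Q' := by
  obtain ⟨s', t, q, he, ht, h⟩ := h
  obtain ⟨s'', t', q', he', ht', h'⟩ := h' s' he.unchanged h
  exact ⟨s'', _, _, .seq he he', Nat.add_le_add ht ht', h'⟩

theorem Runs.ite {c : Test} (h : c.holds s → Runs O B P s Q)
    (h' : ¬ c.holds s → Runs O B P' s Q) : Runs O B (.ite c P P') s Q := by
  by_cases hc : c.holds s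
  · obtain ⟨s', t, q, he, ht, h⟩ := h hc
    exact ⟨s', _, _, .iteTrue hc he, by simp only [Prog.cost]; omega, h⟩
  · obtain ⟨s', t, q, he, ht, h⟩ := h' hc
    exact ⟨s', _, _, .iteFalse hc he, by simp only [Prog.cost]; omega, h⟩

/-- The rule for loops whose number `m` of rounds is known beforehand; `Inv k` holds after `k`
rounds. -/
theorem Runs.loop {c : Test} {m : ℕ} (Inv : ℕ → State → Prop) (hm : m ≤ B c) (h0 : Inv 0 s)
    (hstep : ∀ k < m, ∀ s', Unchanged P s s' → Inv k s' →
      c.holds s' ∧ Runs O B P s' (Inv (k + 1)))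
    (hexit : ∀ s', Inv m s' → ¬ c.holds s') : Runs O B (.loop c P) s (Inv m) := by
  have key : ∀ j ≤ m, ∀ s', Unchanged P s s' → Inv (m - j) s' →
      ∃ s'' t q, Exec O (.loop c P) s' s'' t q ∧ t ≤ j * (P.cost d B + 1) + 1 ∧ Inv m s'' := by
    intro j
    induction j with
    | zero => exact fun _ s' _ h => ⟨s', 1, 0, .loopStop (hexit s' h), by simp, h⟩
    | succ j ih =>
      intro hj s' hu h
      obtain ⟨hc, s₁, t, q, he, ht, h₁⟩ := hstep _ (by omega) s' hu h
      rw [show m - (j + 1) + 1 = m - j by omega] at h₁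
      obtain ⟨s₂, t', q', he', ht', h₂⟩ := ih (by omega) s₁ (hu.trans he.unchanged) h₁
      exact ⟨s₂, _, _, .loopStep hc he he', by rw [Nat.succ_mul]; omega, h₂⟩
  obtain ⟨s', t, q, he, ht, h⟩ := key m le_rfl s (.refl _ _) (by simpa using h0)
  refine ⟨s', t, q, he, ht.trans ?_, h⟩
  simp only [Prog.cost]
  gcongr

end Rules

/-- Straight-line code: the instruction `I`, then the instructions of the list. -/
def block (I : Instr) : List Instr → Prog
  | [] => .instr I
  | J :: L => .seq (.instr I) (block J L)

theorem Runs.block {B : Test → ℕ} {s : State} {Q : State → Prop} {I : Instr} {L : List Instr}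
    (h : Q ((I :: L).foldl (fun s I => I.exec O s) s)) : Runs O B (block I L) s Q := by
  induction L generalizing I s with
  | nil => exact .instr h
  | cons J L ih =>
    refine Runs.seq (Runs.instr (Q := fun s' => s' = I.exec O s) rfl) ?_
    rintro _ - rfl
    exact ih h

/-- The program `for c = 0, …, int b - 1 do P`. Register `16` is used for the increment. -/
def forLt (c b : ℕ) (P : Prog) : Prog :=
  .seq (.instr (.intConst c 0))
    (.loop (.intLt c b) (.seq P (block (.intConst 16 1) [.intAdd c c 16])))

/-- The rule for counting loops. The invariant must not depend on the loop counter and register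
`16`, which change between two executions of the body. -/
theorem Runs.forLt {B : Test → ℕ} {P : Prog} {s : State} {c b m : ℕ} (Inv : ℕ → State → Prop)
    (hb : s.int b = m) (hm : m ≤ B (.intLt c b)) (h0 : Inv 0 (s.setInt c 0))
    (hstep : ∀ k < m, ∀ s', Unchanged (forLt c b P) s s' → s'.int c = k → Inv k s' →
      Runs O B P s' (Inv (k + 1)))
    (hinv : ∀ k s' i j, Inv k s' → Inv k ((s'.setInt 16 i).setInt c j))
    (hPc : P.writesInt c = false := by rfl) (hPb : P.writesInt b = false := by rfl)
    (hcb : c ≠ b := by decide) (hc16 : c ≠ 16 := by decide) (hb16 : b ≠ 16 := by decide) :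
    Runs O B (forLt c b P) s (Inv m) := by
  have hw : ∀ i, (RealRAM.forLt c b P).writesInt i = false → c ≠ i ∧ 16 ≠ i := by
    intro i hi
    simp [RealRAM.forLt, Prog.writesInt, RealRAM.block, Instr.writesInt] at hi
    tauto
  refine (Runs.instr (Q := fun s' => s' = s.setInt c 0) rfl).seq ?_
  rintro s₀ hu₀ rfl
  refine (Runs.loop (fun k s' => Inv k s' ∧ s'.int c = k ∧ s'.int b = m) hm
    ⟨h0, by simp [State.setInt], by simp [State.setInt, hcb.symm, hb]⟩ ?_ ?_).mono
      fun s' _ h => h.1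
  · rintro k hk s' hu ⟨hI, hc, hb⟩
    refine ⟨by simp [Test.holds, hc, hb, hk], ?_⟩
    have hu' : Unchanged (RealRAM.forLt c b P) s s' :=
      (hu₀.of_le (by simp +contextual [RealRAM.forLt, Prog.writesInt])
        (by simp +contextual [RealRAM.forLt, Prog.writesReg])
        (by simp +contextual [RealRAM.forLt, Prog.writesArr])).trans
      (hu.of_le (by simp +contextual [RealRAM.forLt, Prog.writesInt])
        (by simp +contextual [RealRAM.forLt, Prog.writesReg])
        (by simp +contextual [RealRAM.forLt, Prog.writesArr]))
    refine (hstep k hk s' hu' hc hI).seq fun s₁ hu₁ hI₁ => .block ?_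
    have hc₁ := (hu₁.int c hPc).trans hc
    have hb₁ := (hu₁.int b hPb).trans hb
    refine ⟨hinv _ _ _ _ hI₁, ?_, ?_⟩
    · simp [Instr.exec, State.setInt, hc16, hc₁]
    · simp [Instr.exec, State.setInt, hb16, hcb.symm, hb₁]
  · rintro s' ⟨-, hc, hb⟩
    simp [Test.holds, hc, hb]

/-! ### The program and the specifications of its parts -/

/-!
The natural number registers hold: `0` the dimension `d`, `1` the number `n` of functions, `2` the
number `d + 1` of vertices, `3` the number of rounds, `4` whether a point has been recorded, `5`
the number of the fixed vertex, `6` the answer to the membership query, `7` the number of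
doublings; `10`, `11`, `12` are loop counters, and `13` to `16` are auxiliary.

The real registers hold: `0` to `3` the input `ε`, `R`, `r`, `V`, `4` the number `8 * d ^ 2`, `5`
the value of the best point, `6` the value of the query point, `7` the smallest slope, `8` the
number `2 * d * R`; the others are auxiliary.

The arrays hold: `0` the weights, `1` the best point, `2` the vertices (coordinate `j` of vertex
`i` is the entry `i * d + j`), `3` the query point, `4` the cut, `5` a subgradient, `6` the slopes.
-/

/-- A program that fills a matrix with `int 2` rows and `int 0` columns, entry by entry. -/
def grid (P : Prog) : Prog := forLt 11 2 (forLt 12 0 P)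

theorem mul_add_inj_of_lt {l i i' j j' : ℕ} (hj : j < l) (hj' : j' < l) :
    i * l + j = i' * l + j' ↔ i = i' ∧ j = j' := by
  refine ⟨fun h => ?_, fun h => by rw [h.1, h.2]⟩
  have hl : 0 < l := by omega
  have h1 := congrArg (· / l) h
  simp only [Nat.mul_comm _ l, Nat.mul_add_div hl, Nat.div_eq_of_lt hj, Nat.div_eq_of_lt hj'] at h1
  have : i = i' := by simpa using h1
  subst this
  exact ⟨rfl, by omega⟩

/-- While the matrix is filled, the entries before the current one have their new values and the
others their old ones, so that `P` may also read entries of the array that it changes. -/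
theorem Runs.grid {B : Test → ℕ} {P : Prog} {s : State} (a : ℕ) {m l : ℕ} (new : ℕ → ℕ → ℝ)
    (hm : s.int 2 = m) (hl : s.int 0 = l) (hBm : m ≤ B (.intLt 11 2)) (hBl : l ≤ B (.intLt 12 0))
    (hP : ∀ i < m, ∀ j < l, ∀ s', Unchanged (grid P) s s' → s'.int 11 = i → s'.int 12 = j →
      (∀ i', ∀ j' < l, s'.arr a (i' * l + j') =
        if i' < i ∨ i' = i ∧ j' < j then new i' j' else s.arr a (i' * l + j')) →
      Runs O B P s' fun s'' => s''.arr a = Function.update (s'.arr a) (i * l + j) (new i j))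
    (h0 : P.writesInt 0 = false := by rfl) (h2 : P.writesInt 2 = false := by rfl)
    (h11 : P.writesInt 11 = false := by rfl) (h12 : P.writesInt 12 = false := by rfl) :
    Runs O B (grid P) s fun s' => ∀ i < m, ∀ j < l, s'.arr a (i * l + j) = new i j := by
  have hw : ∀ {Q : Prog} {c b i}, (RealRAM.forLt c b Q).writesInt i =
      (c == i || (Q.writesInt i || (16 == i || c == i))) := fun {_ _ _ _} => rfl
  have hw' : ∀ {Q : Prog} {c b i}, (RealRAM.forLt c b Q).writesReg i = Q.writesReg i :=
    fun {_ _ _ _} => by simp [RealRAM.forLt, Prog.writesReg, RealRAM.block, Instr.writesReg]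
  have hw'' : ∀ {Q : Prog} {c b i}, (RealRAM.forLt c b Q).writesArr i = Q.writesArr i :=
    fun {_ _ _ _} => by simp [RealRAM.forLt, Prog.writesArr, RealRAM.block, Instr.writesArr]
  refine (Runs.forLt (fun i s' => ∀ i', ∀ j' < l, s'.arr a (i' * l + j') =
      if i' < i then new i' j' else s.arr a (i' * l + j')) hm hBm (by simp [State.setInt]) ?_
      (fun _ _ _ _ h => h) (by simp [hw, h11]) (by simp [hw, h2])).mono
      fun s' _ h i hi j hj => by rw [h i j hj, if_pos hi]
  intro i hi s₁ hu₁ hi₁ hI₁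
  refine (Runs.forLt (fun j s' => ∀ i', ∀ j' < l, s'.arr a (i' * l + j') =
      if i' < i ∨ i' = i ∧ j' < j then new i' j' else s.arr a (i' * l + j'))
      ((hu₁.int 0 (by simp [hw, h0])).trans hl) hBl ?_ ?_ (fun _ _ _ _ h => h) h12 h0).mono ?_
  · intro i' j' hj'
    simpa [State.setInt] using hI₁ i' j' hj'
  · intro j hj s₂ hu₂ hj₂ hI₂
    refine (hP i hi j hj s₂ (hu₁.trans (hu₂.of_le ?_ ?_ ?_)) ?_ hj₂ hI₂).mono ?_
    · intro k; simp +contextual [hw]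
    · intro k; simp +contextual [hw']
    · intro k; simp +contextual [hw'']
    · rw [hu₂.int 11 (by simp [hw, h11]), hi₁]
    · intro s₃ _ h i' j' hj'
      rw [h, Function.update_apply, hI₂ i' j' hj']
      by_cases hij : i' * l + j' = i * l + j
      · obtain ⟨rfl, rfl⟩ := (mul_add_inj_of_lt hj' hj).1 hij
        simp
      · rw [if_neg hij]
        have : ¬ (i' = i ∧ j' = j) := fun h => hij (by rw [h.1, h.2])
        congr 1
        apply propext
        omega
  · intro s₂ _ h i' j' hj'
    rw [h i' j' hj']
    congr 1
    apply propext
    omega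

/-- Array `3` becomes the mean of the `int 2` rows of the matrix in array `2`. -/
def centroidProg : Prog :=
  forLt 11 0 (.seq
    (.seq (block (.intConst 13 0) [.realOfInt 10 13])
      (forLt 12 2 (block (.intMul 13 12 0) [.intAdd 13 13 11, .load 11 2 13, .add 10 10 11])))
    (block (.realOfInt 11 2) [.div 10 10 11, .store 3 11 10]))

theorem runs_centroidProg {B : Test → ℕ} {s : State} (h0 : s.int 0 = d) (h2 : s.int 2 = d + 1)
    (hB0 : ∀ i, d ≤ B (.intLt i 0)) (hB2 : ∀ i, d + 1 ≤ B (.intLt i 2)) :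
    Runs O B centroidProg s fun s' => ∀ j < d,
      s'.arr 3 j = (∑ i ∈ Finset.range (d + 1), s.arr 2 (i * d + j)) / (d + 1) := by
  refine Runs.forLt (fun j s' => ∀ j' < j,
    s'.arr 3 j' = (∑ i ∈ Finset.range (d + 1), s.arr 2 (i * d + j')) / (d + 1))
    h0 (hB0 _) (by simp) ?_ (fun _ _ _ _ h => h)
  intro j hj s₁ hu₁ hj₁ hI₁
  have e0 := (hu₁.int 0 rfl).trans h0
  have e2 := (hu₁.int 2 rfl).trans h2
  have a2 := hu₁.arr 2 rfl
  refine Runs.seq (Q := fun s' => s'.reg 10 = ∑ i ∈ Finset.range (d + 1), s.arr 2 (i * d + j))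
    (Runs.seq (Q := fun s' => s'.reg 10 = 0) (.block ?_) ?_) ?_
  · simp [Instr.exec, State.setInt, State.setReg]
  · intro s₂ hu₂ h₂
    refine Runs.forLt (fun k s' => s'.reg 10 = ∑ i ∈ Finset.range k, s.arr 2 (i * d + j))
      ((hu₂.int 2 rfl).trans e2) (hB2 _) (by simpa [State.setInt] using h₂) ?_ (fun _ _ _ _ h => h)
    intro k hk s₃ hu₃ hk₃ hI₃
    have := (hu₃.int 0 rfl).trans ((hu₂.int 0 rfl).trans e0)
    have := (hu₃.int 11 rfl).trans ((hu₂.int 11 rfl).trans hj₁)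
    have := (hu₃.arr 2 rfl).trans ((hu₂.arr 2 rfl).trans a2)
    refine .block ?_
    simp [Instr.exec, State.setInt, State.setReg, Finset.sum_range_succ, *]
  · intro s₂ hu₂ h₂
    have := (hu₂.int 2 rfl).trans e2
    have := (hu₂.int 11 rfl).trans hj₁
    have := hu₂.arr 3 rfl
    refine .block ?_
    intro j' hj'
    rcases Nat.lt_succ_iff_lt_or_eq.1 hj' with h | rfl
    · simp [Instr.exec, State.setReg, State.setEntry, *, h.ne]
    · simp [Instr.exec, State.setReg, State.setEntry, *]

/-- Real register `6` and array `4` become the value and a subgradient of the weighted sum of the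
functions of the evaluation oracle, at the point in array `3`. -/
def objectiveProg : Prog :=
  .seq (block (.intConst 13 0) [.realOfInt 6 13]) (.seq
    (forLt 12 0 (block (.intConst 13 0) [.realOfInt 10 13, .store 4 12 10]))
    (forLt 11 1 (.seq
      (block (.load 12 0 11)
        [.callEval 11 11 3, .mul 11 11 12, .add 6 6 11, .callSubgrad 5 11 3])
      (forLt 12 0 (block (.load 11 5 12)
        [.mul 11 11 12, .load 13 4 12, .add 13 13 11, .store 4 12 13])))))

theorem runs_objectiveProg {B : Test → ℕ} {s : State} (h0 : s.int 0 = d) (h1 : s.int 1 = n)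
    (hB0 : ∀ i, d ≤ B (.intLt i 0)) (hB1 : ∀ i, n ≤ B (.intLt i 1)) :
    Runs O B objectiveProg s fun s' =>
      s'.reg 6 = ∑ i : Fin n, s.arr 0 i * O.eval i (s.readVec d 3) ∧
      ∀ j : Fin d, s'.arr 4 j = ∑ i : Fin n, s.arr 0 i * O.subgrad i (s.readVec d 3) j := by
  let E : ℕ → ℝ := fun k => if h : k < n then s.arr 0 k * O.eval ⟨k, h⟩ (s.readVec d 3) else 0
  let G : Fin d → ℕ → ℝ := fun j k =>
    if h : k < n then s.arr 0 k * O.subgrad ⟨k, h⟩ (s.readVec d 3) j else 0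
  refine Runs.seq (Q := fun s' => s'.reg 6 = 0) (.block ?_) ?_
  · simp [Instr.exec, State.setInt, State.setReg]
  intro s₁ hu₁ h₁
  refine Runs.seq (Q := fun s' => ∀ j < d, s'.arr 4 j = 0) ?_ ?_
  · refine Runs.forLt (fun j s' => ∀ j' < j, s'.arr 4 j' = 0) ((hu₁.int 0 rfl).trans h0)
      (hB0 _) (by simp) ?_ (fun _ _ _ _ h => h)
    intro j hj s₂ hu₂ hj₂ hI₂
    refine .block ?_
    intro j' hj'
    rcases Nat.lt_succ_iff_lt_or_eq.1 hj' with h | rfl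
    · simp [Instr.exec, State.setInt, State.setReg, State.setEntry, *, h.ne]
    · simp [Instr.exec, State.setInt, State.setReg, State.setEntry, *]
  intro s₂ hu₂ h₂
  have e0 := (hu₂.int 0 rfl).trans ((hu₁.int 0 rfl).trans h0)
  have e1 := (hu₂.int 1 rfl).trans ((hu₁.int 1 rfl).trans h1)
  have a0 := (hu₂.arr 0 rfl).trans (hu₁.arr 0 rfl)
  have a3 := (hu₂.arr 3 rfl).trans (hu₁.arr 3 rfl)
  have r6 := (hu₂.reg 6 rfl).trans h₁
  refine (Runs.forLt (fun k s' => s'.reg 6 = ∑ i ∈ Finset.range k, E i ∧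
    ∀ j : Fin d, s'.arr 4 j = ∑ i ∈ Finset.range k, G j i) e1 (hB1 _) ?_ ?_
    (fun _ _ _ _ h => h)).mono ?_
  · exact ⟨by simpa [State.setInt] using r6, fun j => by simpa [State.setInt] using h₂ j j.2⟩
  · rintro k hk s₃ hu₃ hk₃ ⟨hE, hG⟩
    have a0' := (hu₃.arr 0 rfl).trans a0
    have x3 : s₃.readVec d 3 = s.readVec d 3 := by
      simp only [State.readVec, (hu₃.arr 3 rfl).trans a3]
    refine Runs.seq (Q := fun s' => s'.reg 6 = ∑ i ∈ Finset.range (k + 1), E i ∧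
      s'.reg 12 = s.arr 0 k ∧
      ∀ j : Fin d, s'.arr 5 j = O.subgrad ⟨k, hk⟩ (s.readVec d 3) j) (.block ?_) ?_
    · have x3' : ∀ x, State.readVec ⟨s₃.int, x, s₃.arr⟩ d 3 = s.readVec d 3 := fun _ => x3
      simp [Instr.exec, State.setReg, State.writeVec, hk₃, hk, x3', a0',
        Finset.sum_range_succ, hE, E, mul_comm (s.arr 0 k)]
    rintro s₄ hu₄ ⟨hE₄, hw₄, hs₄⟩
    have a4 := hu₄.arr 4 rfl
    refine (Runs.forLt (fun l s' => ∀ j : Fin d, s'.arr 4 j =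
      if (j : ℕ) < l then ∑ i ∈ Finset.range (k + 1), G j i else ∑ i ∈ Finset.range k, G j i)
      ((hu₄.int 0 rfl).trans ((hu₃.int 0 rfl).trans e0)) (hB0 _) ?_ ?_
      (fun _ _ _ _ h => h)).mono ?_
    · intro j
      simp [State.setInt, a4, hG]
    · intro l hl s₅ hu₅ hl₅ hI₅ 
      have r12 := (hu₅.reg 12 rfl).trans hw₄
      have a5 := hu₅.arr 5 rfl
      have hl' := hI₅ ⟨l, hl⟩
      have hs := hs₄ ⟨l, hl⟩
      simp only [lt_irrefl, if_false] at hl' hs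
      refine .block ?_
      intro j
      by_cases hj : (j : ℕ) = l
      · obtain rfl : j = ⟨l, hl⟩ := Fin.ext hj
        simp [Instr.exec, State.setReg, State.setEntry, hl₅, a5, r12, hl', hs,
          Finset.sum_range_succ, G, hk, mul_comm]
      · have : ((j : ℕ) < l + 1) = ((j : ℕ) < l) := propext (by omega)
        simp [Instr.exec, State.setReg, State.setEntry, hl₅, hj, hI₅, this]
    · intro s₅ hu₅ h₅
      refine ⟨(hu₅.reg 6 rfl).trans hE₄, fun j => ?_⟩
      rw [h₅ j, if_pos j.2]
  · rintro s₃ - ⟨hE, hG⟩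
    refine ⟨by rw [hE, Finset.sum_range]; simp [E], fun j => ?_⟩
    rw [hG j, Finset.sum_range]
    simp [G]

/-- A program without effect on the registers that matter. -/
def skip : Prog := .instr (.intConst 13 0)

/-- The point in array `3` with the value in register `6` becomes the best point. -/
def recordProg : Prog :=
  .seq (block (.sub 5 5 5) [.add 5 5 6, .intConst 4 1])
    (forLt 12 0 (block (.load 10 3 12) [.store 1 12 10]))

theorem runs_recordProg {B : Test → ℕ} {s : State} (h0 : s.int 0 = d)
    (hB0 : ∀ i, d ≤ B (.intLt i 0)) :
    Runs O B recordProg s fun s' =>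
      0 < s'.int 4 ∧ s'.reg 5 = s.reg 6 ∧ s'.readVec d 1 = s.readVec d 3 := by
  refine Runs.seq (Q := fun s' => 0 < s'.int 4 ∧ s'.reg 5 = s.reg 6) (.block ?_) ?_
  · simp [Instr.exec, State.setInt, State.setReg]
  rintro s₁ hu₁ ⟨h4, h5⟩
  refine (Runs.forLt (fun k s' => ∀ j < k, s'.arr 1 j = s.arr 3 j) ((hu₁.int 0 rfl).trans h0)
    (hB0 _) (by simp) ?_ (fun _ _ _ _ h => h)).mono ?_
  · intro k hk s₂ hu₂ hk₂ hI₂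
    have a3 := (hu₂.arr 3 rfl).trans (hu₁.arr 3 rfl)
    refine .block ?_
    intro j hj
    rcases Nat.lt_succ_iff_lt_or_eq.1 hj with h | rfl
    · simp [Instr.exec, State.setReg, State.setEntry, *, h.ne]
    · simp [Instr.exec, State.setReg, State.setEntry, *]
  · intro s₂ hu₂ h₂
    refine ⟨by rw [hu₂.int 4 rfl]; exact h4, (hu₂.reg 5 rfl).trans h5, ?_⟩
    ext j
    exact h₂ j j.2

/-- The point in array `3` with the value in register `6` becomes the best point, unless a point
that is at least as good has been recorded. -/
def considerProg : Prog :=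
  .seq (.instr (.intConst 13 0))
    (.ite (.intLt 13 4) (.ite (.realLt 6 5) recordProg skip) recordProg)

theorem runs_considerProg {B : Test → ℕ} {s : State} (h0 : s.int 0 = d)
    (hB0 : ∀ i, d ≤ B (.intLt i 0)) :
    Runs O B considerProg s fun s' => 0 < s'.int 4 ∧ s'.reg 5 ≤ s.reg 6 ∧
      (0 < s.int 4 → s'.reg 5 ≤ s.reg 5) ∧
      (s'.reg 5 = s.reg 6 ∧ s'.readVec d 1 = s.readVec d 3 ∨
        0 < s.int 4 ∧ s'.reg 5 = s.reg 5 ∧ s'.readVec d 1 = s.readVec d 1) := by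
  refine Runs.seq (Q := fun s' => s' = s.setInt 13 0) (.instr rfl) ?_
  rintro s' - rfl
  refine .ite (fun h => .ite (fun h' => ?_) fun h' => ?_) fun h => ?_
  · refine (runs_recordProg (s := s.setInt 13 0) h0 hB0).mono ?_
    rintro s₁ - ⟨h₁, h₂, h₃⟩
    exact ⟨h₁, h₂.le, fun _ => h₂.le.trans (le_of_lt h'), .inl ⟨h₂, h₃⟩⟩
  · exact .instr ⟨h, not_lt.1 h', fun _ => le_rfl, .inr ⟨h, rfl, rfl⟩⟩
  · refine (runs_recordProg (s := s.setInt 13 0) h0 hB0).mono ?_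
    rintro s₁ - ⟨h₁, h₂, h₃⟩
    exact ⟨h₁, h₂.le, fun h' => absurd h' h, .inl ⟨h₂, h₃⟩⟩

/-- Array `6` receives the values of the linear form in array `4` at the differences of the vertices
in array `2` and the point in array `3`; their minimum goes into register `7`, and the number of a
vertex at which it is attained into `int 5`. As the values have mean zero, the search for the
minimum can start from `0`. -/
def slopesProg : Prog :=
  .seq (block (.intConst 5 0) [.realOfInt 7 5])
    (forLt 11 2 (.seq
      (.seq (block (.intConst 13 0) [.realOfInt 10 13])
        (forLt 12 0 (block (.intMul 13 11 0) [.intAdd 13 13 12, .load 11 2 13, .load 12 3 12,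
          .sub 11 11 12, .load 12 4 12, .mul 11 11 12, .add 10 10 11])))
      (.seq (.instr (.store 6 11 10))
        (.ite (.realLt 10 7)
          (block (.sub 7 7 7) [.add 7 7 10, .intConst 13 0, .intAdd 5 11 13])
          skip))))

theorem runs_slopesProg {B : Test → ℕ} {s : State} (h0 : s.int 0 = d) (h2 : s.int 2 = d + 1)
    (hB0 : ∀ i, d ≤ B (.intLt i 0)) (hB2 : ∀ i, d + 1 ≤ B (.intLt i 2)) (H : ℕ → ℝ)
    (hH : ∀ i < d + 1,
      H i = ∑ j ∈ Finset.range d, (s.arr 2 (i * d + j) - s.arr 3 j) * s.arr 4 j) :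
    Runs O B slopesProg s fun s' => (∀ i < d + 1, s'.arr 6 i = H i) ∧
      (∀ i < d + 1, s'.reg 7 ≤ H i) ∧ s'.int 5 < d + 1 ∧
      (s'.reg 7 = 0 ∨ H (s'.int 5) = s'.reg 7) := by
  refine Runs.seq (Q := fun s' => s'.reg 7 = 0 ∧ s'.int 5 = 0) (.block ?_) ?_
  · simp [Instr.exec, State.setInt, State.setReg]
  rintro s₁ hu₁ ⟨h₁, h₁'⟩
  refine (Runs.forLt (fun k s' => (∀ i < k, s'.arr 6 i = H i) ∧
      (∀ i < k, s'.reg 7 ≤ H i) ∧ s'.int 5 < d + 1 ∧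
      (s'.reg 7 = 0 ∨ H (s'.int 5) = s'.reg 7)) ((hu₁.int 2 rfl).trans h2) (hB2 _)
      ⟨by simp, by simp, by simp [State.setInt, h₁'], .inl h₁⟩ ?_ (fun _ _ _ _ h => h))
  rintro k hk s₂ hu₂ hk₂ ⟨hA, hmin, hlt, hatt⟩
  refine Runs.seq (Q := fun s' => s'.reg 10 = H k)
    (Runs.seq (Q := fun s' => s'.reg 10 = 0) (.block ?_) ?_) ?_
  · simp [Instr.exec, State.setInt, State.setReg]
  · intro s₃ hu₃ h₃
    rw [hH k hk]
    refine Runs.forLt (fun l s' => s'.reg 10 =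
      ∑ j ∈ Finset.range l, (s.arr 2 (k * d + j) - s.arr 3 j) * s.arr 4 j)
      ((hu₃.int 0 rfl).trans ((hu₂.int 0 rfl).trans ((hu₁.int 0 rfl).trans h0)))
      (hB0 _) (by simpa [State.setInt] using h₃) ?_ (fun _ _ _ _ h => h)
    intro l hl s₄ hu₄ hl₄ hI₄
    have := (hu₄.int 0 rfl).trans ((hu₃.int 0 rfl).trans ((hu₂.int 0 rfl).trans
      ((hu₁.int 0 rfl).trans h0)))
    have := (hu₄.int 11 rfl).trans ((hu₃.int 11 rfl).trans hk₂)
    have := (hu₄.arr 2 rfl).trans ((hu₃.arr 2 rfl).trans ((hu₂.arr 2 rfl).trans (hu₁.arr 2 rfl)))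
    have := (hu₄.arr 3 rfl).trans ((hu₃.arr 3 rfl).trans ((hu₂.arr 3 rfl).trans (hu₁.arr 3 rfl)))
    have := (hu₄.arr 4 rfl).trans ((hu₃.arr 4 rfl).trans ((hu₂.arr 4 rfl).trans (hu₁.arr 4 rfl)))
    refine .block ?_
    simp [Instr.exec, State.setInt, State.setReg, Finset.sum_range_succ, *]
  · intro s₃ hu₃ h₃
    have e5 := hu₃.int 5 rfl
    have e11 := (hu₃.int 11 rfl).trans hk₂
    have e7 := hu₃.reg 7 rfl
    refine Runs.seq (Q := fun s' => s' = s₃.setEntry 6 k (H k)) (.instr ?_) ?_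
    · simp [Instr.exec, e11, h₃]
    rintro s₄ - rfl
    have hA' : ∀ i < k + 1, (s₃.setEntry 6 k (H k)).arr 6 i = H i := by
      intro i hi
      rcases Nat.lt_succ_iff_lt_or_eq.1 hi with h | rfl
      · simp [State.setEntry, h.ne, hu₃.arr 6 rfl, hA i h]
      · simp [State.setEntry]
    refine .ite (fun h => .block ⟨hA', ?_⟩) fun h => .instr ⟨hA', ?_⟩
    · simp only [Test.holds, State.setEntry, h₃, e7] at h
      simp [Instr.exec, State.setInt, State.setReg, State.setEntry, h₃, e11, hk]
      intro i hi
      rcases Nat.lt_succ_iff_lt_or_eq.1 (Nat.lt_succ_of_le hi) with h' | rfl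
      · exact h.le.trans (hmin i h')
      · exact le_rfl
    · simp only [Test.holds, State.setEntry, h₃, e7, not_lt] at h
      simp only [Instr.exec, State.setInt, State.setEntry]
      rw [Function.update_of_ne (by decide), e5, e7]
      refine ⟨fun i hi => ?_, hlt, hatt⟩
      rcases Nat.lt_succ_iff_lt_or_eq.1 hi with h' | rfl
      · exact hmin i h'
      · exact h

/-- The vertices in array `2` are moved on their edges through the vertex with the number in
`int 5`. -/
def updateProg : Prog :=
  grid (block (.load 10 6 11) [.mul 11 4 7, .div 10 10 11, .intConst 13 1, .realOfInt 11 13,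
    .sub 10 11 10, .intMul 13 11 0, .intAdd 13 13 12, .intMul 14 5 0, .intAdd 14 14 12,
    .load 11 2 13, .load 12 2 14, .sub 11 11 12, .div 11 11 10, .add 11 12 11, .store 2 13 11])

theorem runs_updateProg {B : Test → ℕ} {s : State} (h0 : s.int 0 = d) (h2 : s.int 2 = d + 1)
    (hB0 : ∀ i, d ≤ B (.intLt i 0)) (hB2 : ∀ i, d + 1 ≤ B (.intLt i 2)) :
    Runs O B updateProg s fun s' => ∀ i < d + 1, ∀ j < d, s'.arr 2 (i * d + j) =
      s.arr 2 (s.int 5 * d + j) + (s.arr 2 (i * d + j) - s.arr 2 (s.int 5 * d + j)) /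
        (1 - s.arr 6 i / (s.reg 4 * s.reg 7)) := by
  refine Runs.grid 2 (fun i j => s.arr 2 (s.int 5 * d + j) +
      (s.arr 2 (i * d + j) - s.arr 2 (s.int 5 * d + j)) /
        (1 - s.arr 6 i / (s.reg 4 * s.reg 7))) h2 h0 (hB2 _) (hB0 _) ?_
  intro i hi j hj s₁ hu₁ hi₁ hj₁ hI₁
  have := (hu₁.int 0 rfl).trans h0
  have := hu₁.int 5 rfl
  have := hu₁.reg 4 rfl
  have := hu₁.reg 7 rfl
  have := hu₁.arr 6 rfl
  have hij := hI₁ i j hj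
  have hkj := hI₁ (s.int 5) j hj
  -- the row of the fixed vertex is overwritten by itself
  simp only [sub_self, zero_div, add_zero, ite_self] at hkj
  simp only [lt_irrefl, and_false, or_false, if_false] at hij
  refine .block ?_
  simp [Instr.exec, State.setInt, State.setReg, State.setEntry, *]

/-- The query at the point in array `3`: a separating vector or a subgradient of the objective is
written into array `4`, and a feasible point is considered as a candidate for the best point. -/
def queryProg : Prog :=
  .seq (.instr (.callSep 6 4 3)) (.seq (.instr (.intConst 13 0))
    (.ite (.intLt 13 6) (.seq objectiveProg considerProg) skip))

/-- One round of the simplex method: a query at the centroid, and the change of the simplex. -/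
def roundProg : Prog :=
  .seq centroidProg (.seq queryProg (.seq slopesProg updateProg))

/-- The computation of the auxiliary numbers and of the number `int 3` of rounds. -/
def setupProg : Prog :=
  .seq (block (.intConst 13 1) [.intAdd 2 0 13, .intConst 14 8, .intMul 14 14 0, .intMul 14 14 0,
    .realOfInt 4 14, .intConst 14 2, .intMul 14 14 0, .realOfInt 8 14, .mul 8 8 1, .div 9 8 2,
    .div 10 3 0, .realOfInt 11 13, .add 10 11 10, .mul 9 9 10, .realOfInt 10 13, .intConst 7 0])
  (.seq (.loop (.realLt 10 9) (block (.add 10 10 10) [.intAdd 7 7 13]))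
    (block (.intAdd 7 7 13) [.intConst 14 16, .intMul 14 14 0, .intMul 14 14 0, .intMul 14 14 0,
      .intMul 3 14 7]))

theorem runs_setupProg {B : Test → ℕ} {s : State} (h0 : s.int 0 = d) {N : ℕ}
    (hN : 2 * d * s.reg 1 / s.reg 2 * (1 + s.reg 3 / s.reg 0) ≤ 2 ^ N)
    (hN' : ∀ k < N, (2 : ℝ) ^ k < 2 * d * s.reg 1 / s.reg 2 * (1 + s.reg 3 / s.reg 0))
    (hB : N ≤ B (.realLt 10 9)) :
    Runs O B setupProg s fun s' => s'.int 2 = d + 1 ∧ s'.reg 4 = 8 * d * d ∧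
      s'.reg 8 = 2 * d * s.reg 1 ∧ s'.int 3 = 16 * d * d * d * (N + 1) := by
  set u := 2 * d * s.reg 1 / s.reg 2 * (1 + s.reg 3 / s.reg 0)
  refine Runs.seq (Q := fun s' => s'.int 2 = d + 1 ∧ s'.reg 4 = 8 * d * d ∧
      s'.reg 8 = 2 * d * s.reg 1 ∧ s'.int 13 = 1 ∧ s'.reg 9 = u ∧ s'.reg 10 = 1 ∧ s'.int 7 = 0)
      (.block ?_) ?_
  · simp [Instr.exec, State.setInt, State.setReg, h0, u]
  rintro s₁ hu₁ ⟨h2, h4, h8, h13, h9, h10, h7⟩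
  refine Runs.seq (Runs.loop (fun k s' => s'.reg 10 = 2 ^ k ∧ s'.int 7 = k ∧ s'.reg 9 = u ∧
    s'.int 13 = 1) hB (by simp [*]) ?_ ?_) ?_
  · rintro k hk s₂ hu₂ ⟨g10, g7, g9, g13⟩
    refine ⟨by simpa [Test.holds, g10, g9] using hN' k hk, .block ?_⟩
    simp [Instr.exec, State.setInt, State.setReg, *]
    ring
  · rintro s₂ ⟨g10, g7, g9, g13⟩
    simpa [Test.holds, g10, g9] using hN
  · rintro s₂ hu₂ ⟨g10, g7, g9, g13⟩
    have := (hu₂.int 0 rfl).trans ((hu₁.int 0 rfl).trans h0)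
    have := (hu₂.int 2 rfl).trans h2
    have := (hu₂.reg 4 rfl).trans h4
    have := (hu₂.reg 8 rfl).trans h8
    refine .block ?_
    simp [Instr.exec, State.setInt, *]

/-- The initial simplex: row `0` of array `2` has the entries `-reg 1`, and in row `i + 1` the
number `reg 8` is added to entry `i`. -/
def initProg : Prog :=
  grid (block (.intConst 13 1) [.intAdd 14 12 13, .intSub 15 11 14, .intSub 14 14 11,
    .intAdd 14 14 15, .intSub 14 13 14, .realOfInt 10 14, .mul 10 10 8, .sub 10 10 1,
    .intMul 13 11 0, .intAdd 13 13 12, .store 2 13 10])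

theorem runs_initProg {B : Test → ℕ} {s : State} (h0 : s.int 0 = d) (h2 : s.int 2 = d + 1)
    (hB0 : ∀ i, d ≤ B (.intLt i 0)) (hB2 : ∀ i, d + 1 ≤ B (.intLt i 2)) :
    Runs O B initProg s fun s' => ∀ i < d + 1, ∀ j < d, s'.arr 2 (i * d + j) =
      (if i = j + 1 then s.reg 8 else 0) - s.reg 1 := by
  refine Runs.grid 2 (fun i j => (if i = j + 1 then s.reg 8 else 0) - s.reg 1)
    h2 h0 (hB2 _) (hB0 _) ?_
  intro i hi j hj s₁ hu₁ hi₁ hj₁ hI₁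
  have := (hu₁.int 0 rfl).trans h0
  have := hu₁.reg 8 rfl
  have := hu₁.reg 1 rfl
  -- with truncated subtraction, the indicator of `i = j + 1` is computed without a test
  have key : 1 - (j + 1 - i + (i - (j + 1))) = if i = j + 1 then 1 else 0 := by
    split_ifs <;> omega
  refine .block ?_
  simp [Instr.exec, State.setInt, State.setReg, State.setEntry, *]

/-- The simplex method. -/
def simplexProg : Prog :=
  .seq setupProg (.seq initProg (forLt 10 3 roundProg))

end RealRAM

namespace PredictivePrescription

open RealRAM

variable {d : ℕ}

/-! ### Geometry of simplices -/

/-- The matrix with the rows `(1, v i)`. The absolute value of its determinant is `d!` times the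
volume of the simplex with the vertices `v i`. -/
def vertexMatrix (v : Fin (d + 1) → Vec d) : Matrix (Fin (d + 1)) (Fin (d + 1)) ℝ :=
  .of fun i => Fin.cons 1 (v i)

/-- The point `p` is a convex combination of the points `v i`. -/
def InSimplex (v : Fin (d + 1) → Vec d) (p : Vec d) : Prop :=
  ∃ a : Fin (d + 1) → ℝ, (∀ i, 0 ≤ a i) ∧ ∑ i, a i = 1 ∧ ∑ i, a i • v i = p

/-- The vertices `b` and `b + ρ e_l` of a simplex with a right-angled corner at `b`. -/
noncomputable def cornerSimplex (b : Vec d) (ρ : ℝ) : Fin (d + 1) → Vec d :=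
  Fin.cons b fun l => b + ρ • EuclideanSpace.single l 1

theorem det_vertexMatrix_cornerSimplex (b : Vec d) (ρ : ℝ) :
    (vertexMatrix (cornerSimplex b ρ)).det = ρ ^ d := by
  let A : Matrix (Fin (d + 1)) (Fin (d + 1)) ℝ := .of fun i => Fin.cases (Fin.cons 1 b)
    (fun l => Fin.cons 0 (ρ • EuclideanSpace.single l (1 : ℝ) : Vec d)) i
  have hA : A.BlockTriangular id := by
    intro i j hij
    induction i using Fin.cases with
    | zero => exact absurd hij (Fin.not_lt_zero _)
    | succ i =>
      induction j using Fin.cases with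
      | zero => simp [A]
      | succ j =>
        have : j ≠ i := fun h => by simp [h] at hij
        simp [A, this]
  rw [Matrix.det_eq_of_forall_row_eq_smul_add_const (B := A) (Fin.cons 0 fun _ => 1) 0 rfl,
    Matrix.det_of_isUpperTriangular hA, Fin.prod_univ_succ]
  · simp [A]
  · intro i j
    induction i using Fin.cases <;> induction j using Fin.cases <;>
      simp [A, vertexMatrix, cornerSimplex, add_comm]

theorem abs_det_le_one_of_stochastic {m : Type*} [Fintype m] [DecidableEq m] (A : Matrix m m ℝ)
    (h0 : ∀ i j, 0 ≤ A i j) (h1 : ∀ i, ∑ j, A i j = 1) : |A.det| ≤ 1 := by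
  classical
  rw [← Matrix.det_transpose, Matrix.det_apply]
  calc |∑ σ : Equiv.Perm m, Equiv.Perm.sign σ • ∏ i, A.transpose (σ i) i|
      ≤ ∑ σ : Equiv.Perm m, ∏ i, A i (σ i) := by
        refine (Finset.abs_sum_le_sum_abs _ _).trans (Finset.sum_le_sum fun σ _ => ?_)
        rcases Int.units_eq_one_or (Equiv.Perm.sign σ) with h | h <;>
          simp [h, abs_of_nonneg (Finset.prod_nonneg fun i _ => h0 i (σ i))]
    _ ≤ ∑ f : m → m, ∏ i, A i (f i) := by
        rw [← Finset.sum_image (s := Finset.univ) (g := fun σ : Equiv.Perm m => (σ : m → m))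
          (f := fun f => ∏ i, A i (f i)) (by intro σ _ τ _ h; exact DFunLike.coe_injective h)]
        exact Finset.sum_le_sum_of_subset_of_nonneg (Finset.subset_univ _)
          fun f _ _ => Finset.prod_nonneg fun i _ => h0 i _
    _ = ∏ i, ∑ j, A i j := by
        rw [Finset.prod_univ_sum (fun _ => Finset.univ) fun i j => A i j, Fintype.piFinset_univ]
    _ = 1 := by simp [h1]

theorem abs_det_vertexMatrix_le {v p : Fin (d + 1) → Vec d} (h : ∀ l, InSimplex v (p l)) :
    |(vertexMatrix p).det| ≤ |(vertexMatrix v).det| := by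
  choose a h0 h1 h using h
  have hM : vertexMatrix p = Matrix.of a * vertexMatrix v := by
    ext l j
    induction j using Fin.cases with
    | zero => simp [vertexMatrix, Matrix.mul_apply, h1]
    | succ j => simp [vertexMatrix, Matrix.mul_apply, ← h]
  rw [hM, Matrix.det_mul, abs_mul]
  exact mul_le_of_le_one_left (abs_nonneg _) (abs_det_le_one_of_stochastic _ h0 h1)

/-- The vertices of the simplex that results when the vertices `v i` are moved on the edges through
`v k`: the vector from `v k` to `v i` is divided by `c i`. -/
noncomputable def pullVertices (v : Fin (d + 1) → Vec d) (k : Fin (d + 1)) (c : Fin (d + 1) → ℝ) :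
    Fin (d + 1) → Vec d :=
  fun i => v k + (c i)⁻¹ • (v i - v k)

theorem det_vertexMatrix_pullVertices (v : Fin (d + 1) → Vec d) (k : Fin (d + 1))
    (c : Fin (d + 1) → ℝ) :
    (vertexMatrix (pullVertices v k c)).det =
      (∏ i ∈ Finset.univ.erase k, (c i)⁻¹) * (vertexMatrix v).det := by
  let e : Fin (d + 1) → ℝ := fun i => if i = k then 1 else (c i)⁻¹
  rw [Matrix.det_eq_of_forall_row_eq_smul_add_const
    (B := Matrix.of fun i j => e i * vertexMatrix v i j) (fun i => 1 - e i) k (by simp [e]),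
    Matrix.det_mul_column, ← Finset.mul_prod_erase _ _ (Finset.mem_univ k)]
  · congr 1
    simp only [e, if_true, one_mul]
    exact Finset.prod_congr rfl fun i hi => if_neg (Finset.ne_of_mem_erase hi)
  · intro i j
    by_cases hi : i = k
    · subst hi
      induction j using Fin.cases <;> simp [vertexMatrix, pullVertices, e]
    · induction j using Fin.cases <;> simp [vertexMatrix, pullVertices, e, hi]
      ring

/-- In terms of barycentric coordinates: the constraint `0 ≤ a k` of the old simplex is replaced by
its sum with a multiple of the constraint `∑ a i * h i ≤ 0` of the half-space. -/
theorem InSimplex.pullVertices {v : Fin (d + 1) → Vec d} {k : Fin (d + 1)} {h : Fin (d + 1) → ℝ}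
    {t : ℝ} (ht0 : 0 ≤ t) (ht1 : t < 1) (hk : h k = -1) (hh : ∀ i, -1 ≤ h i)
    {a : Fin (d + 1) → ℝ} (ha : ∀ i, 0 ≤ a i) (ha1 : ∑ i, a i = 1) (hah : ∑ i, a i * h i ≤ 0) :
    InSimplex (pullVertices v k fun i => 1 + t * h i) (∑ i, a i • v i) := by
  have hc : ∀ i, 0 < 1 + t * h i := fun i => by nlinarith [hh i]
  have hs : ∑ i ∈ Finset.univ.erase k, a i * (1 + t * h i) =
      1 + t * ∑ i, a i * h i - a k * (1 - t) := by
    have h1 : ∑ i, a i * (1 + t * h i) = 1 + t * ∑ i, a i * h i := by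
      simp only [mul_add, mul_one, Finset.sum_add_distrib, ha1, Finset.mul_sum]
      exact congrArg _ (Finset.sum_congr rfl fun i _ => by ring)
    rw [← h1, ← Finset.add_sum_erase _ _ (Finset.mem_univ k), hk]
    ring
  refine ⟨fun i => if i = k then 1 - ∑ i ∈ Finset.univ.erase k, a i * (1 + t * h i)
    else a i * (1 + t * h i), fun i => ?_, ?_, ?_⟩
  · dsimp only
    split_ifs
    · rw [hs]
      nlinarith [ha k]
    · exact mul_nonneg (ha i) (hc i).le
  · rw [← Finset.add_sum_erase _ _ (Finset.mem_univ k), if_pos rfl,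
      Finset.sum_congr rfl fun i hi => if_neg (Finset.ne_of_mem_erase hi)]
    ring
  · have h1 : ∀ A, ∀ i ∈ Finset.univ.erase k, (if i = k then A else a i * (1 + t * h i)) •
        PredictivePrescription.pullVertices v k (fun i => 1 + t * h i) i =
          (a i * (1 + t * h i)) • v k + (a i • v i - a i • v k) := by
      intro A i hi
      have := (hc i).ne'
      rw [if_neg (Finset.ne_of_mem_erase hi), PredictivePrescription.pullVertices, smul_add,
        smul_smul, mul_assoc, mul_inv_cancel₀ this, mul_one, smul_sub]
    rw [← Finset.add_sum_erase _ _ (Finset.mem_univ k),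
      ← Finset.add_sum_erase _ (fun i => a i • v i) (Finset.mem_univ k)]
    dsimp only
    rw [if_pos rfl, Finset.sum_congr rfl (h1 _), Finset.sum_add_distrib, Finset.sum_sub_distrib,
      ← Finset.sum_smul, ← Finset.sum_smul]
    have h2 : ∑ i ∈ Finset.univ.erase k, a i = 1 - a k := by
      rw [← ha1, ← Finset.add_sum_erase _ _ (Finset.mem_univ k)]
      ring
    rw [h2, PredictivePrescription.pullVertices, sub_self, smul_zero, add_zero]
    module

/-- The product is estimated through its logarithm, with `x - 2 * x ^ 2 ≤ log (1 + x)` and with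
`∑ h i ^ 2 ≤ 2 * d ^ 2`, which holds since the numbers `h i + 1` are nonnegative with sum
`d + 1`. -/
theorem exp_le_prod {ι : Type*} (s : Finset ι) (hs : s.card = d) (hd : 0 < d) (h : ι → ℝ)
    (h1 : ∀ i ∈ s, -1 ≤ h i) (hsum : ∑ i ∈ s, h i = 1) :
    Real.exp (1 / (16 * d ^ 2)) ≤ ∏ i ∈ s, (1 + 1 / (8 * d ^ 2) * h i) := by
  have hd' : (1 : ℝ) ≤ d := by exact_mod_cast hd
  have hd2 : (1 : ℝ) ≤ d ^ 2 := one_le_pow₀ hd'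
  set t : ℝ := 1 / (8 * d ^ 2) with ht
  have ht0 : 0 < t := by positivity
  have htd : t * d ^ 2 = 1 / 8 := by
    rw [ht]
    field_simp
  have ht1 : t ≤ 1 / 8 := by nlinarith [mul_nonneg ht0.le (sub_nonneg.2 hd2)]
  have hc : ∀ i ∈ s, -(1 / 8) ≤ t * h i := fun i hi => by nlinarith [h1 i hi]
  have hlog : ∀ x : ℝ, -(1 / 8) ≤ x → x - 2 * x ^ 2 ≤ Real.log (1 + x) := by
    intro x hx
    have h3 : 0 < 1 + x := by linarith
    refine le_trans ?_ (Real.one_sub_inv_le_log_of_pos h3)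
    rw [← sub_nonneg]
    have : 1 - (1 + x)⁻¹ - (x - 2 * x ^ 2) = x ^ 2 * (1 + 2 * x) / (1 + x) := by
      field_simp
      ring
    rw [this]
    exact div_nonneg (mul_nonneg (sq_nonneg x) (by linarith)) h3.le
  have hsum' : ∑ i ∈ s, (h i + 1) = d + 1 := by
    rw [Finset.sum_add_distrib, hsum]
    simp [hs, add_comm]
  have hsq : ∑ i ∈ s, h i ^ 2 ≤ 2 * d ^ 2 := by
    calc ∑ i ∈ s, h i ^ 2 ≤ ∑ i ∈ s, ((d + 1) * (h i + 1) - 2 * h i - 1) := by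
          refine Finset.sum_le_sum fun i hi => ?_
          have h2 : h i + 1 ≤ d + 1 := by
            rw [← hsum']
            exact Finset.single_le_sum (f := fun i => h i + 1)
              (fun j hj => by linarith [h1 j hj]) hi
          nlinarith [h1 i hi]
      _ = (d + 1) * (d + 1) - 2 - d := by
          rw [Finset.sum_sub_distrib, Finset.sum_sub_distrib, ← Finset.mul_sum, ← Finset.mul_sum,
            hsum', hsum]
          simp [hs]
      _ ≤ 2 * d ^ 2 := by nlinarith
  have hpos : ∀ i ∈ s, 0 < 1 + t * h i := fun i hi => by linarith [hc i hi]
  rw [← Real.le_log_iff_exp_le (Finset.prod_pos hpos), Real.log_prod fun i hi => (hpos i hi).ne']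
  calc 1 / (16 * (d : ℝ) ^ 2) = t - 2 * (t * t * (2 * d ^ 2)) := by
        rw [ht]
        field_simp
        norm_num
    _ ≤ t - 2 * (t * t * ∑ i ∈ s, h i ^ 2) := by gcongr
    _ = ∑ i ∈ s, (t * h i - 2 * (t * h i) ^ 2) := by
        rw [Finset.sum_sub_distrib, ← Finset.mul_sum, ← Finset.mul_sum, hsum, Finset.mul_sum]
        simp only [mul_pow, mul_one, ← sq]
    _ ≤ ∑ i ∈ s, Real.log (1 + t * h i) := Finset.sum_le_sum fun i hi => hlog _ (hc i hi)

/-- The centroid of a simplex. -/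
noncomputable def centroid (v : Fin (d + 1) → Vec d) : Vec d := ((d : ℝ) + 1)⁻¹ • ∑ i, v i

theorem sum_inner_sub_centroid (v : Fin (d + 1) → Vec d) (g : Vec d) :
    ∑ i, inner ℝ g (v i - centroid v) = 0 := by
  rw [← inner_sum, Finset.sum_sub_distrib, Finset.sum_const, centroid, Finset.card_univ,
    Fintype.card_fin, ← Nat.cast_smul_eq_nsmul ℝ, smul_smul]
  push_cast
  rw [mul_inv_cancel₀ (by positivity), one_smul, sub_self, inner_zero_right]

/-- A vector that is orthogonal to the differences of the vertices of a corner simplex vanishes. -/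
theorem eq_zero_of_inner_cornerSimplex {b x g : Vec d} {ρ : ℝ} (hρ : ρ ≠ 0)
    (h : ∀ l, inner ℝ g (cornerSimplex b ρ l - x) = 0) : g = 0 := by
  ext l
  have h0 := h 0
  have h1 := h l.succ
  simp only [cornerSimplex, Fin.cons_zero, Fin.cons_succ] at h0 h1
  rw [add_sub_right_comm, inner_add_right, h0, zero_add, inner_smul_right] at h1
  simpa [hρ, EuclideanSpace.inner_single_right] using h1

/-- One round of the simplex method with the cut `⟪g, z⟫ ≤ ⟪g, centroid v⟫`, where `μ` is the
smallest slope of `g` at a vertex. The search for `μ` starts from `0`, so that `k` is known to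
attain `μ` only if `μ ≠ 0`. This always holds: if `μ = 0`, then all slopes vanish, whence `g` is
constant on the corner simplex, and `g = 0`. -/
theorem simplex_round (hd : 0 < d) {v : Fin (d + 1) → Vec d} {b g : Vec d} {ρ : ℝ} (hρ : ρ ≠ 0)
    (hg : g ≠ 0) (hin : ∀ l, InSimplex v (cornerSimplex b ρ l))
    (hcut : ∀ l, inner ℝ g (cornerSimplex b ρ l - centroid v) ≤ 0)
    {k : Fin (d + 1)} {μ : ℝ} (hμ : ∀ i, μ ≤ inner ℝ g (v i - centroid v))
    (hk : μ = 0 ∨ inner ℝ g (v k - centroid v) = μ) {c : Fin (d + 1) → ℝ}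
    (hc : ∀ i, c i = 1 - inner ℝ g (v i - centroid v) / (8 * d * d * μ)) :
    (∀ l, InSimplex (pullVertices v k c) (cornerSimplex b ρ l)) ∧
      |(vertexMatrix (pullVertices v k c)).det| ≤
        Real.exp (-(1 / (16 * d ^ 2))) * |(vertexMatrix v).det| := by
  have hd' : (1 : ℝ) ≤ d := by exact_mod_cast hd
  set H : Fin (d + 1) → ℝ := fun i => inner ℝ g (v i - centroid v) with hH
  have hsum : ∑ i, H i = 0 := sum_inner_sub_centroid v g
  have hcomb : ∀ a : Fin (d + 1) → ℝ, ∑ i, a i = 1 →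
      inner ℝ g (∑ i, a i • v i - centroid v) = ∑ i, a i * H i := by
    intro a ha
    have : ∑ i, a i • v i - centroid v = ∑ i, a i • (v i - centroid v) := by
      simp only [smul_sub, Finset.sum_sub_distrib, ← Finset.sum_smul, ha, one_smul]
    rw [this, inner_sum]
    exact Finset.sum_congr rfl fun i _ => inner_smul_right _ _ _
  have hμ0 : μ < 0 := by
    by_contra! h0
    have hz : ∀ i, H i = 0 := fun i =>
      (Finset.sum_eq_zero_iff_of_nonneg fun i _ => h0.trans (hμ i)).1 hsum i (Finset.mem_univ i)
    refine hg (eq_zero_of_inner_cornerSimplex hρ (b := b) (x := centroid v) fun l => ?_)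
    obtain ⟨a, -, ha1, ha⟩ := hin l
    rw [← ha, hcomb a ha1]
    simp [hz]
  have hk : H k = μ := hk.resolve_left hμ0.ne
  have hc' : c = fun i => 1 + 1 / (8 * (d : ℝ) ^ 2) * (H i / -μ) := by
    ext i
    rw [hc]
    field_simp
    ring
  have h1 : ∀ i, -1 ≤ H i / -μ := fun i => by
    rw [le_div_iff₀ (by linarith)]
    linarith [hμ i]
  have hk1 : H k / -μ = -1 := by
    rw [hk, div_neg, div_self hμ0.ne]
  have ht1 : 1 / (8 * (d : ℝ) ^ 2) < 1 := by
    rw [div_lt_one (by positivity)]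
    nlinarith
  refine ⟨fun l => ?_, ?_⟩
  · obtain ⟨a, ha0, ha1, ha⟩ := hin l
    rw [hc', ← ha]
    refine InSimplex.pullVertices (by positivity) ht1 hk1 h1 ha0 ha1 ?_
    have := hcut l
    rw [← ha, hcomb a ha1] at this
    have h2 : ∑ i, a i * (H i / -μ) = (∑ i, a i * H i) / -μ := by
      rw [Finset.sum_div]
      exact Finset.sum_congr rfl fun i _ => by ring
    rw [h2]
    exact div_nonpos_of_nonpos_of_nonneg this (by linarith)
  · have hprod := exp_le_prod (d := d) (Finset.univ.erase k) (by simp) hd (fun i => H i / -μ)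
      (fun i _ => h1 i) (by
        have h2 := Finset.add_sum_erase Finset.univ (fun i => H i / -μ) (Finset.mem_univ k)
        have h3 : ∑ i, H i / -μ = 0 := by rw [← Finset.sum_div, hsum, zero_div]
        rw [h3] at h2
        linarith)
    rw [det_vertexMatrix_pullVertices, abs_mul, Finset.prod_inv_distrib, abs_inv, Real.exp_neg, hc',
      abs_of_pos ((Real.exp_pos _).trans_le hprod)]
    gcongr

end PredictivePrescription

namespace PredictivePrescription

open RealRAM

variable {d n : ℕ}

/-! ### Correctness of one round -/

/-- The homothety with center at the minimizer `z₀` and ratio `δ` maps the ball of radius `r` to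
points that exceed the minimum by at most `δ * V`. -/
theorem isEpsOptimal_cornerSimplex {Z : Set (Vec d)} {F : Vec d → ℝ} {ε r V δ : ℝ} {z₀ a : Vec d}
    (hF : ConvexOn ℝ Z F) (hz₀ : z₀ ∈ Z) (hmin : ∀ z ∈ Z, F z₀ ≤ F z) (hr : 0 ≤ r)
    (ha : Metric.closedBall a r ⊆ Z) (hV : ∀ z ∈ Metric.closedBall a r, F z - F z₀ ≤ V)
    (hδ0 : 0 ≤ δ) (hδ1 : δ ≤ 1) (hδ : δ * V ≤ ε) (l : Fin (d + 1)) :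
    IsEpsOptimal Z F ε (cornerSimplex ((1 - δ) • z₀ + δ • a) (δ * r) l) := by
  obtain ⟨q, hq, h⟩ : ∃ q ∈ Metric.closedBall a r,
      cornerSimplex ((1 - δ) • z₀ + δ • a) (δ * r) l = (1 - δ) • z₀ + δ • q := by
    induction l using Fin.cases with
    | zero => exact ⟨a, Metric.mem_closedBall_self hr, rfl⟩
    | succ l =>
      refine ⟨a + r • EuclideanSpace.single l 1, ?_, ?_⟩
      · simp [norm_smul, abs_of_nonneg hr]
      · simp only [cornerSimplex, Fin.cons_succ]
        module
  rw [h]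
  refine ⟨hF.1 hz₀ (ha hq) (by linarith) hδ0 (by ring), fun z hz => ?_⟩
  have h1 := hF.2 hz₀ (ha hq) (show 0 ≤ 1 - δ by linarith) hδ0 (by ring)
  have h2 := mul_le_mul_of_nonneg_left (hV q hq) hδ0
  simp only [smul_eq_mul] at h1
  linarith [hmin z hz]

/-- The ball of radius `R` is convex. This is the preceding lemma for the objective `0`. -/
theorem norm_cornerSimplex_le {r R δ : ℝ} {z₀ a : Vec d} (hz₀ : ‖z₀‖ ≤ R) (hr : 0 ≤ r)
    (ha : Metric.closedBall a r ⊆ Metric.closedBall 0 R) (hδ0 : 0 ≤ δ) (hδ1 : δ ≤ 1)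
    (l : Fin (d + 1)) : ‖cornerSimplex ((1 - δ) • z₀ + δ • a) (δ * r) l‖ ≤ R := by
  have h := (isEpsOptimal_cornerSimplex (F := fun _ => 0) (ε := 0) (V := 0)
    (convexOn_const 0 (convex_closedBall (0 : Vec d) R)) (by simpa using hz₀) (by simp) hr ha
    (by simp) hδ0 hδ1 (by simp) l).1
  simpa using h

/-- The initial simplex contains the ball of radius `R` around the origin. -/
theorem inSimplex_cornerSimplex (hd : 0 < d) {R : ℝ} (hR : 0 < R) {z : Vec d} (hz : ‖z‖ ≤ R) :
    InSimplex (cornerSimplex (WithLp.toLp 2 fun _ => -R) (2 * d * R)) z := by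
  have hd' : (0 : ℝ) < d := by exact_mod_cast hd
  have hc : ∀ j, |z j| ≤ R := fun j => (PiLp.norm_apply_le z j).trans hz
  have hne : 2 * d * R ≠ 0 := by positivity
  have hs : ∑ j, (z j + R) / (2 * d * R) ≤ 1 := by
    rw [← Finset.sum_div, div_le_one (by positivity)]
    calc ∑ j, (z j + R) ≤ ∑ j : Fin d, 2 * R :=
          Finset.sum_le_sum fun j _ => by linarith [(abs_le.1 (hc j)).2]
      _ = 2 * d * R := by
          simp
          ring
  refine ⟨Fin.cons (1 - ∑ j, (z j + R) / (2 * d * R)) fun j => (z j + R) / (2 * d * R),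
    fun i => ?_, ?_, ?_⟩
  · induction i using Fin.cases with
    | zero => simpa using hs
    | succ j =>
      simp only [Fin.cons_succ]
      exact div_nonneg (by linarith [(abs_le.1 (hc j)).1]) (by positivity)
  · rw [Fin.sum_univ_succ]
    simp
  · ext k
    rw [Fin.sum_univ_succ]
    simp only [cornerSimplex, Fin.cons_zero, Fin.cons_succ, WithLp.ofLp_add, WithLp.ofLp_smul,
      WithLp.ofLp_sum, Pi.add_apply, Pi.smul_apply, Finset.sum_apply, smul_eq_mul, mul_add,
      Finset.sum_add_distrib, ← Finset.sum_mul, PiLp.single_apply, mul_ite, mul_one, mul_zero,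
      Finset.sum_ite_eq, Finset.mem_univ, if_true, div_mul_cancel₀ _ hne]
    ring

/-- The vertices of the simplex that is stored in array `2`. -/
def vertices (d : ℕ) (s : State) : Fin (d + 1) → Vec d :=
  fun i => WithLp.toLp 2 fun j => s.arr 2 (i * d + j)

theorem vertices_congr {s s' : State} (h : s'.arr 2 = s.arr 2) : vertices d s' = vertices d s := by
  unfold vertices
  rw [h]

theorem readVec_congr {s s' : State} {a : ℕ} (h : s'.arr a = s.arr a) :
    s'.readVec d a = s.readVec d a := by
  simp only [State.readVec, h]

section Method

variable {O : Oracles d n} {B : Test → ℕ} {Z : Set (Vec d)} {F : Vec d → ℝ} {ω : Fin n → ℝ}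
  {ε ρ : ℝ} {b : Vec d}

/-- If a point has been recorded, which is indicated by `0 < int 4`, then it is feasible, and
register `5` holds its value. -/
def BestValid (Z : Set (Vec d)) (F : Vec d → ℝ) (s : State) : Prop :=
  0 < s.int 4 → s.readVec d 1 ∈ Z ∧ F (s.readVec d 1) = s.reg 5

/-- An `ε`-optimal point has been recorded. -/
def BestOptimal (Z : Set (Vec d)) (F : Vec d → ℝ) (ε : ℝ) (s : State) : Prop :=
  0 < s.int 4 ∧ ∀ z ∈ Z, s.reg 5 ≤ F z + ε

theorem BestValid.congr {s s' : State} (h : BestValid Z F s) (h4 : s'.int 4 = s.int 4)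
    (h5 : s'.reg 5 = s.reg 5) (h1 : s'.arr 1 = s.arr 1) : BestValid Z F s' := by
  simpa only [BestValid, h4, h5, readVec_congr h1] using h

theorem BestOptimal.congr {s s' : State} (h : BestOptimal Z F ε s) (h4 : s'.int 4 = s.int 4)
    (h5 : s'.reg 5 = s.reg 5) : BestOptimal Z F ε s' := by
  simpa only [BestOptimal, h4, h5] using h

/-- After the query at `x`, unless an `ε`-optimal point has been recorded, array `4` holds a cut
through `x` that keeps all vertices of the corner simplex. -/
theorem runs_query {s : State} {x : Vec d} (h0 : s.int 0 = d) (h1 : s.int 1 = n)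
    (hω : ∀ i : Fin n, s.arr 0 i = ω i) (hx : s.readVec d 3 = x)
    (hB0 : ∀ i, d ≤ B (.intLt i 0)) (hB1 : ∀ i, n ≤ B (.intLt i 1))
    (hsep : IsSeparationOracle Z O.sep)
    (hval : ∀ z ∈ Z, ∑ i, ω i * O.eval i z = F z)
    (hsub : ∀ z ∈ Z, ∀ z' ∈ Z, F z + inner ℝ (∑ i, ω i • O.subgrad i z) (z' - z) ≤ F z')
    (hopt : ∀ l, IsEpsOptimal Z F ε (cornerSimplex b ρ l)) (hbest : BestValid Z F s) :
    Runs O B queryProg s fun s' =>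
        BestValid Z F s' ∧ (BestOptimal Z F ε s → BestOptimal Z F ε s') ∧
        (BestOptimal Z F ε s' ∨ s'.readVec d 4 ≠ 0 ∧
          ∀ l, inner ℝ (s'.readVec d 4) (cornerSimplex b ρ l - x) ≤ 0) := by
  refine Runs.seq (Q := fun s' => x ∈ Z ∧ s'.int 6 = 1 ∨ s'.int 6 = 0 ∧ s'.readVec d 4 ≠ 0 ∧
    ∀ z ∈ Z, inner ℝ (s'.readVec d 4) z ≤ inner ℝ (s'.readVec d 4) x) (.instr ?_) ?_
  · simp only [Instr.exec, hx]
    by_cases hxZ : x ∈ Z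
    · rw [(hsep x).1 hxZ]
      exact .inl ⟨hxZ, by simp [State.setInt]⟩
    · obtain ⟨a, ha, ha0, hcut⟩ := (hsep x).2 hxZ
      rw [ha]
      have : ((s.setInt 6 0).writeVec 4 a).readVec d 4 = a := by
        ext j
        simp [State.readVec, State.writeVec]
      exact .inr ⟨by simp [State.setInt, State.writeVec], by rw [this]; exact ⟨ha0, hcut⟩⟩
  intro s₁ hu₁ h
  refine Runs.seq (Q := fun s' => s' = s₁.setInt 13 0) (.instr rfl) ?_
  rintro s₂ hu₂ rfl
  refine .ite (fun hc => ?_) fun hc => .instr ?_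
  · have hxZ : x ∈ Z := by
      rcases h with h | h
      · exact h.1
      · simp [Test.holds, State.setInt, h.1] at hc
    have hx' : s₁.readVec d 3 = x := (readVec_congr (hu₁.arr 3 rfl)).trans hx
    have hω' : ∀ i : Fin n, s₁.arr 0 i = ω i := fun i => by rw [hu₁.arr 0 rfl, hω]
    refine (runs_objectiveProg (s := s₁.setInt 13 0) ((hu₁.int 0 rfl).trans h0)
      ((hu₁.int 1 rfl).trans h1) hB0 hB1).seq ?_
    rintro s₃ hu₃ ⟨hE, hG⟩
    replace hE : s₃.reg 6 = F x := by
      rw [hE, ← hval x hxZ]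
      simp only [State.setInt] at hx' ⊢
      exact Finset.sum_congr rfl fun i _ => by rw [hω' i, ← hx']; rfl
    replace hG : s₃.readVec d 4 = ∑ i, ω i • O.subgrad i x := by
      ext j
      simp only [State.readVec, hG j, WithLp.ofLp_sum, WithLp.ofLp_smul, Finset.sum_apply,
        Pi.smul_apply, smul_eq_mul]
      exact Finset.sum_congr rfl fun i _ => by rw [← hx', ← hω' i]; rfl
    refine (runs_considerProg ((hu₃.int 0 rfl).trans ((hu₁.int 0 rfl).trans h0)) hB0).mono ?_
    rintro s₄ hu₄ ⟨hpos, hle, hle', hrec⟩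
    rw [hE] at hle
    have e4 : s₃.int 4 = s.int 4 := (hu₃.int 4 rfl).trans (hu₁.int 4 rfl)
    have e5 : s₃.reg 5 = s.reg 5 := (hu₃.reg 5 rfl).trans (hu₁.reg 5 rfl)
    refine ⟨fun _ => ?_, fun ho => ⟨hpos, fun z hz => ?_⟩, ?_⟩
    · rcases hrec with ⟨h5, hv⟩ | ⟨h4, h5, hv⟩
      · have : s₃.readVec d 3 = x := (readVec_congr (hu₃.arr 3 rfl)).trans hx'
        rw [hv, h5, this]
        exact ⟨hxZ, hE.symm⟩
      · have : s₃.readVec d 1 = s.readVec d 1 :=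
          (readVec_congr (hu₃.arr 1 rfl)).trans (readVec_congr (hu₁.arr 1 rfl))
        rw [hv, h5, this, e5]
        exact hbest (e4 ▸ h4)
    · exact (hle' (by rw [e4]; exact ho.1)).trans (e5 ▸ ho.2 z hz)
    · have hg : s₄.readVec d 4 = ∑ i, ω i • O.subgrad i x :=
        (readVec_congr (hu₄.arr 4 rfl)).trans hG
      by_cases hl : ∃ l, 0 ≤ inner ℝ (s₄.readVec d 4) (cornerSimplex b ρ l - x)
      · -- a vertex in the half-space that is cut off is not better than the query point
        obtain ⟨l, hl⟩ := hl
        refine .inl ⟨hpos, fun z hz => ?_⟩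
        have h2 := hsub x hxZ _ (hopt l).1
        rw [← hg] at h2
        linarith [(hopt l).2 z hz]
      · push Not at hl
        refine .inr ⟨fun h0 => ?_, fun l => (hl l).le⟩
        have := hl 0
        rw [h0, inner_zero_left] at this
        exact lt_irrefl _ this
  · have h' := h.resolve_left fun h => hc (by simp [Test.holds, State.setInt, h.2])
    refine ⟨hbest.congr (hu₁.int 4 rfl) (hu₁.reg 5 rfl) (hu₁.arr 1 rfl),
      fun ho => ho.congr (hu₁.int 4 rfl) (hu₁.reg 5 rfl), .inr ⟨h'.2.1, fun l => ?_⟩⟩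
    rw [inner_sub_right]
    exact sub_nonpos.2 (h'.2.2 _ (hopt l).1)

/-- The move of the vertices, in the form in which `simplex_round` applies to it. -/
theorem runs_move {s : State} {v : Fin (d + 1) → Vec d} {g : Vec d} (h0 : s.int 0 = d)
    (h2 : s.int 2 = d + 1) (h4 : s.reg 4 = 8 * d * d) (hv : vertices d s = v)
    (hx : s.readVec d 3 = centroid v) (hg : s.readVec d 4 = g)
    (hB0 : ∀ i, d ≤ B (.intLt i 0)) (hB2 : ∀ i, d + 1 ≤ B (.intLt i 2)) :
    Runs O B (.seq slopesProg updateProg) s fun s' => ∃ (k : Fin (d + 1)) (μ : ℝ),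
      (∀ i, μ ≤ inner ℝ g (v i - centroid v)) ∧ (μ = 0 ∨ inner ℝ g (v k - centroid v) = μ) ∧
      vertices d s' = pullVertices v k fun i =>
        1 - inner ℝ g (v i - centroid v) / (8 * d * d * μ) := by
  subst hv hg
  set v := vertices d s
  set g := s.readVec d 4
  refine (runs_slopesProg h0 h2 hB0 hB2
    (fun i => if h : i < d + 1 then inner ℝ g (v ⟨i, h⟩ - centroid v) else 0) ?_).seq ?_
  · intro i hi
    rw [dif_pos hi, ← hx, PiLp.inner_apply, Finset.sum_range]
    rfl
  rintro s₁ hu₁ ⟨hA, hmin, hlt, hatt⟩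
  refine (runs_updateProg ((hu₁.int 0 rfl).trans h0) ((hu₁.int 2 rfl).trans h2) hB0 hB2).mono ?_
  intro s₂ hu₂ h
  refine ⟨⟨s₁.int 5, hlt⟩, s₁.reg 7, fun i => ?_, hatt.imp_right fun h => ?_, ?_⟩
  · simpa only [dif_pos i.2] using hmin i i.2
  · simpa [hlt] using h
  · ext i j
    have h' := h i i.2 j j.2
    rw [hA i i.2, dif_pos i.2, hu₁.reg 4 rfl, h4, hu₁.arr 2 rfl] at h'
    simp only [vertices, h', pullVertices, v]
    simp [div_eq_inv_mul]

/-- The invariant of the main loop after `k` rounds, where `D` is the determinant of the initial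
simplex. -/
def RoundInv (Z : Set (Vec d)) (F : Vec d → ℝ) (ε : ℝ) (b : Vec d) (ρ D : ℝ) (k : ℕ)
    (s : State) : Prop :=
  BestValid Z F s ∧ (BestOptimal Z F ε s ∨
    (∀ l, InSimplex (vertices d s) (cornerSimplex b ρ l)) ∧
      |(vertexMatrix (vertices d s)).det| ≤ Real.exp (-(1 / (16 * d ^ 2))) ^ k * D)

theorem RoundInv.setInt {D : ℝ} {k i j : ℕ} {s : State} (h : RoundInv Z F ε b ρ D k s) :
    RoundInv Z F ε b ρ D k ((s.setInt 16 i).setInt 10 j) := by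
  have h4 : ((s.setInt 16 i).setInt 10 j).int 4 = s.int 4 := by simp [State.setInt]
  exact ⟨h.1.congr h4 rfl rfl, h.2.imp_left fun ho => ho.congr h4 rfl⟩

theorem runs_roundProg (hd : 0 < d) (hρ : ρ ≠ 0) {D : ℝ} {k : ℕ} {s : State} (h0 : s.int 0 = d)
    (h1 : s.int 1 = n) (h2 : s.int 2 = d + 1) (h4 : s.reg 4 = 8 * d * d)
    (hω : ∀ i : Fin n, s.arr 0 i = ω i)
    (hB0 : ∀ i, d ≤ B (.intLt i 0)) (hB1 : ∀ i, n ≤ B (.intLt i 1))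
    (hB2 : ∀ i, d + 1 ≤ B (.intLt i 2))
    (hsep : IsSeparationOracle Z O.sep)
    (hval : ∀ z ∈ Z, ∑ i, ω i * O.eval i z = F z)
    (hsub : ∀ z ∈ Z, ∀ z' ∈ Z, F z + inner ℝ (∑ i, ω i • O.subgrad i z) (z' - z) ≤ F z')
    (hopt : ∀ l, IsEpsOptimal Z F ε (cornerSimplex b ρ l)) (hinv : RoundInv Z F ε b ρ D k s) :
    Runs O B roundProg s (RoundInv Z F ε b ρ D (k + 1)) := by
  set v := vertices d s with hv
  refine Runs.seq (Q := fun s' => s'.readVec d 3 = centroid v)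
    ((runs_centroidProg h0 h2 hB0 hB2).mono ?_) ?_
  · intro s' _ h
    ext j
    simp only [State.readVec, h j j.2, centroid, Finset.sum_range, v, vertices, WithLp.ofLp_smul,
      WithLp.ofLp_sum, Pi.smul_apply, Finset.sum_apply, smul_eq_mul]
    rw [div_eq_inv_mul]
  intro s₁ hu₁ hx
  have hbest₁ := hinv.1.congr (hu₁.int 4 rfl) (hu₁.reg 5 rfl) (hu₁.arr 1 rfl)
  refine Runs.seq (runs_query (x := centroid v) ((hu₁.int 0 rfl).trans h0)
    ((hu₁.int 1 rfl).trans h1) (fun i => by rw [hu₁.arr 0 rfl, hω]) hx hB0 hB1 hsep hval hsub hopt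
    hbest₁) ?_
  rintro s₂ hu₂ ⟨hbest₂, ho₂, hcut⟩
  have u2 : s₂.arr 2 = s.arr 2 := (hu₂.arr 2 rfl).trans (hu₁.arr 2 rfl)
  refine (runs_move (v := v) ((hu₂.int 0 rfl).trans ((hu₁.int 0 rfl).trans h0))
    ((hu₂.int 2 rfl).trans ((hu₁.int 2 rfl).trans h2))
    ((hu₂.reg 4 rfl).trans ((hu₁.reg 4 rfl).trans h4)) (vertices_congr u2)
    ((readVec_congr (hu₂.arr 3 rfl)).trans hx) rfl hB0 hB2).mono ?_
  rintro s₃ hu₃ ⟨i, μ, hμ, hi, hv₃⟩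
  refine ⟨hbest₂.congr (hu₃.int 4 rfl) (hu₃.reg 5 rfl) (hu₃.arr 1 rfl), ?_⟩
  have hstay : BestOptimal Z F ε s₂ → BestOptimal Z F ε s₃ :=
    fun h => h.congr (hu₃.int 4 rfl) (hu₃.reg 5 rfl)
  rcases hinv.2 with h | ⟨hin, hdet⟩
  · exact .inl (hstay (ho₂ (h.congr (hu₁.int 4 rfl) (hu₁.reg 5 rfl))))
  rcases hcut with h | ⟨hg, hcut⟩
  · exact .inl (hstay h)
  obtain ⟨hin', hdet'⟩ := simplex_round hd hρ hg hin hcut hμ hi fun _ => rfl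
  refine .inr ⟨by rw [hv₃]; exact hin', ?_⟩
  rw [hv₃]
  refine hdet'.trans ?_
  rw [pow_succ' _ k, mul_assoc]
  gcongr

end Method

end PredictivePrescription

namespace PredictivePrescription

open RealRAM

variable {d n : ℕ}

/-! ### The number of rounds, and correctness of the method -/

/-- Bounds for the numbers of rounds of the loops of the simplex method: `N` doublings, and
`16 * d ^ 3 * (N + 1)` rounds of the main loop. -/
def roundBound (d n N : ℕ) : Test → ℕ
  | .intLt _ 0 => d
  | .intLt _ 1 => n
  | .intLt _ 2 => d + 1
  | .intLt _ _ => 16 * d * d * d * (N + 1)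
  | .realLt _ _ => N

theorem roundBound_le (d n N : ℕ) (c : Test) :
    roundBound d n N c ≤ d + 1 + n + 16 * d * d * d * (N + 1) + N := by
  unfold roundBound
  split <;> omega

theorem cost_roundBound_le (P : Prog) {N : ℕ} {S : ℝ} (hS : 1 + n + d ≤ S) (hN : N ≤ 5 * S) :
    (P.cost d (roundBound d n N) : ℝ) ≤ P.size * 104 ^ P.depth * S ^ (4 * P.depth) := by
  have hn0 : (0 : ℝ) ≤ n := Nat.cast_nonneg n
  have hd0 : (0 : ℝ) ≤ d := Nat.cast_nonneg d
  have hS1 : 1 ≤ S := by linarith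
  have hdS : (d : ℝ) ≤ S := by linarith
  have hcost := P.cost_le (d := d) (X := d + 1 + n + 16 * d * d * d * (N + 1) + N) (by omega)
    (roundBound_le d n N)
  set X := d + 1 + n + 16 * d * d * d * (N + 1) + N with hX
  have hXS : (X : ℝ) ≤ 104 * S ^ 4 := by
    rw [hX]
    push_cast
    have h1 : S ≤ S ^ 4 := le_self_pow₀ hS1 (by norm_num)
    have h2 : 16 * (d : ℝ) * d * d * (N + 1) ≤ 16 * S * S * S * (5 * S + S) := by gcongr
    calc (d : ℝ) + 1 + n + 16 * d * d * d * (N + 1) + N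
        ≤ S + 16 * S * S * S * (5 * S + S) + 5 * S := by linarith
      _ = 96 * S ^ 4 + 6 * S := by ring
      _ ≤ 104 * S ^ 4 := by linarith
  calc (P.cost d (roundBound d n N) : ℝ) ≤ P.size * (X : ℝ) ^ P.depth := by exact_mod_cast hcost
    _ ≤ P.size * (104 * S ^ 4) ^ P.depth := by gcongr
    _ = _ := by rw [mul_pow, pow_mul, mul_assoc]

/-- The volume bound after the last round is too small for the corner simplex. -/
theorem exp_pow_mul_lt (hd : 0 < d) {N : ℕ} {A ρ : ℝ} (hA : 0 < A) (hρ : A ≤ ρ * 2 ^ N) :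
    Real.exp (-(1 / (16 * d ^ 2))) ^ (16 * d * d * d * (N + 1)) * A ^ d < ρ ^ d := by
  have hd' : (0 : ℝ) < d := by exact_mod_cast hd
  have h2 : (2 : ℝ) ≤ Real.exp 1 := by linarith [Real.exp_one_gt_d9]
  have hρ0 : 0 < ρ := pos_of_mul_pos_left (hA.trans_le hρ) (by positivity)
  have h1 : Real.exp (-(1 / (16 * d ^ 2))) ^ (16 * d * d * d * (N + 1)) =
      (Real.exp 1 ^ (N + 1))⁻¹ ^ d := by
    rw [← Real.exp_nat_mul, ← Real.exp_nat_mul, ← Real.exp_neg, ← Real.exp_nat_mul]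
    congr 1
    push_cast
    field_simp
  rw [h1, ← mul_pow]
  refine pow_lt_pow_left₀ ?_ (by positivity) hd.ne'
  rw [inv_mul_lt_iff₀ (by positivity)]
  calc A ≤ ρ * 2 ^ N := hρ
    _ < ρ * 2 ^ (N + 1) := by
        exact mul_lt_mul_of_pos_left (pow_lt_pow_right₀ one_lt_two (Nat.lt_succ_self N)) hρ0
    _ ≤ ρ * Real.exp 1 ^ (N + 1) := by gcongr
    _ = Real.exp 1 ^ (N + 1) * ρ := mul_comm _ _

theorem runs_simplexProg {O : Oracles d n} {Z : Set (Vec d)} {F : Vec d → ℝ} {ω : Fin n → ℝ}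
    {ε R r V : ℝ} {N : ℕ} {s : State} (h0 : s.int 0 = d) (h1 : s.int 1 = n) (h4 : s.int 4 = 0)
    (hε' : s.reg 0 = ε) (hR' : s.reg 1 = R) (hr' : s.reg 2 = r) (hV' : s.reg 3 = V)
    (hω : ∀ i : Fin n, s.arr 0 i = ω i)
    (hsep : IsSeparationOracle Z O.sep)
    (hval : ∀ z ∈ Z, ∑ i, ω i * O.eval i z = F z)
    (hsub : ∀ z ∈ Z, ∀ z' ∈ Z, F z + inner ℝ (∑ i, ω i • O.subgrad i z) (z' - z) ≤ F z')
    (hF : ConvexOn ℝ Z F) (hε : 0 < ε)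
    (hmin : ∃ z₀ ∈ Z, ‖z₀‖ ≤ R ∧ ∀ z ∈ Z, F z₀ ≤ F z) (hr : 0 < r)
    (hball : ∃ a : Vec d, Metric.closedBall a r ⊆ Z ∩ Metric.closedBall 0 R)
    (hV : ∀ z ∈ Z ∩ Metric.closedBall 0 R, ∀ z' ∈ Z ∩ Metric.closedBall 0 R, F z - F z' ≤ V)
    (hN : 2 * d * R / r * (1 + V / ε) ≤ 2 ^ N)
    (hN' : ∀ k < N, (2 : ℝ) ^ k < 2 * d * R / r * (1 + V / ε)) :
    Runs O (roundBound d n N) simplexProg s fun s' => IsEpsOptimal Z F ε (s'.readVec d 1) := by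
  obtain ⟨z₀, hz₀, hz₀R, hmin⟩ := hmin
  obtain ⟨a, ha⟩ := hball
  have haZ : Metric.closedBall a r ⊆ Z := fun z hz => (ha hz).1
  have haR : Metric.closedBall a r ⊆ Metric.closedBall 0 R := fun z hz => (ha hz).2
  have hB0 : ∀ i, d ≤ roundBound d n N (.intLt i 0) := fun _ => le_rfl
  have hB1 : ∀ i, n ≤ roundBound d n N (.intLt i 1) := fun _ => le_rfl
  have hB2 : ∀ i, d + 1 ≤ roundBound d n N (.intLt i 2) := fun _ => le_rfl
  refine (runs_setupProg (N := N) h0 (by rwa [hε', hR', hr', hV']) (by rwa [hε', hR', hr', hV'])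
    le_rfl).seq ?_
  rintro s₁ hu₁ ⟨g2, g4, g8, g3⟩
  refine (runs_initProg ((hu₁.int 0 rfl).trans h0) g2 hB0 hB2).seq ?_
  intro s₂ hu₂ hinit
  have e4 : s₂.int 4 = 0 := (hu₂.int 4 rfl).trans ((hu₁.int 4 rfl).trans h4)
  have e3 := (hu₂.int 3 rfl).trans g3
  rcases Nat.eq_zero_or_pos d with rfl | hd
  -- in dimension `0` the main loop is not entered, and there is only one point
  · refine Runs.forLt (fun _ s' => IsEpsOptimal Z F ε (s'.readVec 0 1)) e3 le_rfl ?_ ?_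
      (fun _ _ _ _ h => h)
    · refine ⟨haZ ?_, fun z' _ => ?_⟩
      · rw [Subsingleton.elim (State.readVec _ 0 1) a]
        exact Metric.mem_closedBall_self hr.le
      · rw [Subsingleton.elim (State.readVec _ 0 1) z']
        linarith
    · intro k hk
      simp at hk
  have hd' : (0 : ℝ) < d := by exact_mod_cast hd
  -- a ball of positive radius is not contained in a point
  have hR : 0 < R := by
    have h1 : ∀ t : ℝ, |t| ≤ r → ‖a + t • EuclideanSpace.single (⟨0, hd⟩ : Fin d) (1 : ℝ)‖ ≤ R := by
      intro t ht
      have : a + t • EuclideanSpace.single (⟨0, hd⟩ : Fin d) (1 : ℝ) ∈ Metric.closedBall a r := by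
        simpa [norm_smul] using ht
      simpa using haR this
    have h2 := h1 r (abs_of_pos hr).le
    have h3 := h1 0 (by simpa using hr.le)
    by_contra! hR
    have h4 := norm_le_zero_iff.1 (h2.trans hR)
    have h5 := norm_le_zero_iff.1 (h3.trans hR)
    rw [zero_smul, add_zero] at h5
    rw [h5, zero_add, smul_eq_zero] at h4
    rcases h4 with h4 | h4
    · exact hr.ne' h4
    · simp at h4
  have hV0 : 0 ≤ V := by
    have hmem : a ∈ Z ∩ Metric.closedBall 0 R := ha (Metric.mem_closedBall_self hr.le)
    simpa using hV a hmem a hmem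
  -- the homothety with ratio `δ` about the minimizer keeps the loss of optimality below `ε`
  set δ : ℝ := (1 + V / ε)⁻¹ with hδ
  have hq : 0 ≤ V / ε := div_nonneg hV0 hε.le
  have hδ0 : 0 < δ := by positivity
  have hδ1 : δ ≤ 1 := inv_le_one_of_one_le₀ (by linarith)
  have hδV : δ * V ≤ ε := by
    rw [hδ, inv_mul_le_iff₀ (by positivity)]
    have : (1 + V / ε) * ε = ε + V := by field_simp
    linarith
  set b : Vec d := (1 - δ) • z₀ + δ • a
  set ρ : ℝ := δ * r
  have hρ : 0 < ρ := mul_pos hδ0 hr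
  have hopt : ∀ l, IsEpsOptimal Z F ε (cornerSimplex b ρ l) :=
    isEpsOptimal_cornerSimplex hF hz₀ hmin hr.le haZ
      (fun z hz => hV z (ha hz) z₀ ⟨hz₀, by simpa using hz₀R⟩) hδ0.le hδ1 hδV
  have hvert : vertices d s₂ = cornerSimplex (WithLp.toLp 2 fun _ => -R) (2 * d * R) := by
    ext i j
    simp only [vertices, hinit i i.2 j j.2, g8, hu₁.reg 1 rfl, hR']
    induction i using Fin.cases with
    | zero => simp [cornerSimplex]
    | succ i =>
      by_cases hij : i = j
      · subst hij
        simp [cornerSimplex]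
        ring
      · have : (i : ℕ) ≠ j := fun h => hij (Fin.ext h)
        simp [cornerSimplex, this, Ne.symm hij]
  have hA : 0 < 2 * d * R := by positivity
  refine (Runs.forLt (RoundInv Z F ε b ρ ((2 * d * R) ^ d)) e3 le_rfl ⟨?_, .inr ⟨?_, ?_⟩⟩ ?_
    (fun _ _ _ _ h => h.setInt)).mono ?_
  · intro h
    simp [State.setInt, e4] at h
  · intro l
    change InSimplex (vertices d s₂) _
    rw [hvert]
    exact inSimplex_cornerSimplex hd hR (norm_cornerSimplex_le hz₀R hr.le haR hδ0.le hδ1 l)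
  · change |(vertexMatrix (vertices d s₂)).det| ≤ _
    rw [hvert, det_vertexMatrix_cornerSimplex,
      abs_of_pos (pow_pos hA d)]
    simp
  · intro k _ s₃ hu₃ _ hinv
    exact runs_roundProg hd hρ.ne'
      ((hu₃.int 0 rfl).trans ((hu₂.int 0 rfl).trans ((hu₁.int 0 rfl).trans h0)))
      ((hu₃.int 1 rfl).trans ((hu₂.int 1 rfl).trans ((hu₁.int 1 rfl).trans h1)))
      ((hu₃.int 2 rfl).trans ((hu₂.int 2 rfl).trans g2))
      ((hu₃.reg 4 rfl).trans ((hu₂.reg 4 rfl).trans g4))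
      (fun i => by rw [hu₃.arr 0 rfl, hu₂.arr 0 rfl, hu₁.arr 0 rfl, hω])
      hB0 hB1 hB2 hsep hval hsub hopt hinv
  · rintro s₃ - ⟨hbest, ho⟩
    have ho : BestOptimal Z F ε s₃ := by
      refine ho.resolve_right fun ⟨hin, hdet⟩ => ?_
      have h1 := (abs_det_vertexMatrix_le hin).trans hdet
      rw [det_vertexMatrix_cornerSimplex, abs_of_pos (pow_pos hρ d)] at h1
      refine absurd h1 (not_le.2 (exp_pow_mul_lt hd hA ?_))
      calc 2 * d * R = ρ * (2 * d * R / r * (1 + V / ε)) := by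
            simp only [ρ, hδ]
            field_simp
        _ ≤ ρ * 2 ^ N := by gcongr
    obtain ⟨hZ, hval⟩ := hbest ho.1
    exact ⟨hZ, fun z hz => by rw [hval]; exact ho.2 z hz⟩

/-- The number of doublings is bounded by a logarithm. -/
theorem exists_doublings (d : ℕ) {x q : ℝ} (hx : 0 ≤ x) (hq : 0 ≤ q) :
    ∃ N : ℕ, 2 * d * x * (1 + q) ≤ 2 ^ N ∧ (∀ k < N, (2 : ℝ) ^ k < 2 * d * x * (1 + q)) ∧
      (N : ℝ) ≤ 5 * (1 + d + Real.log (2 + x) + Real.log (2 + q)) := by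
  classical
  have hex : ∃ N : ℕ, 2 * d * x * (1 + q) ≤ 2 ^ N :=
    (pow_unbounded_of_one_lt (2 * d * x * (1 + q)) one_lt_two).imp fun _ h => h.le
  have hmin : ∀ k < Nat.find hex, (2 : ℝ) ^ k < 2 * d * x * (1 + q) :=
    fun k hk => not_le.1 (Nat.find_min hex hk)
  have hl1 : 0 ≤ Real.log (2 + x) := Real.log_nonneg (by linarith)
  have hl2 : 0 ≤ Real.log (2 + q) := Real.log_nonneg (by linarith)
  refine ⟨Nat.find hex, Nat.find_spec hex, hmin, ?_⟩
  rcases Nat.eq_zero_or_eq_succ_pred (Nat.find hex) with h | h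
  · rw [h, Nat.cast_zero]
    have : (0 : ℝ) ≤ d := Nat.cast_nonneg d
    linarith
  · set M := (Nat.find hex).pred
    have hM := hmin M (by omega)
    have hpos : 0 < 2 * d * x * (1 + q) := lt_trans (by positivity) hM
    have hd : (0 : ℝ) < d := by
      rcases Nat.eq_zero_or_pos d with rfl | hd
      · simp at hpos
      · exact_mod_cast hd
    have hx0 : 0 < x := by
      refine hx.lt_of_ne' fun h => ?_
      simp [h] at hpos
    have hlog := Real.log_lt_log (by positivity) hM
    rw [Real.log_pow, Real.log_mul (by positivity) (by positivity),
      Real.log_mul (by positivity) hx0.ne', Real.log_mul two_ne_zero hd.ne'] at hlog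
    have h2 := Real.log_two_gt_d9
    have h2' := Real.log_two_lt_d9
    have h3 := Real.log_le_sub_one_of_pos hd
    have h4 : Real.log x ≤ Real.log (2 + x) := Real.log_le_log hx0 (by linarith)
    have h5 : Real.log (1 + q) ≤ Real.log (2 + q) := Real.log_le_log (by linarith) (by linarith)
    have hM0 : (0 : ℝ) ≤ M := Nat.cast_nonneg M
    rw [h]
    push_cast
    nlinarith

theorem sum_mul_eq_sum_activeIndex {N : ℕ} {w : Fin N → ℝ} (hw : ∀ i, 0 ≤ w i) (f : Fin N → ℝ) :
    ∑ i, w i * f i = ∑ j, w (activeIndex w j) * f (activeIndex w j) := by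
  have h1 : ∑ i ∈ active w, w i * f i = ∑ i, w i * f i := by
    refine Finset.sum_subset (Finset.subset_univ _) fun i _ hi => ?_
    have : w i = 0 := le_antisymm (by simpa [active] using hi) (hw i)
    rw [this, zero_mul]
  rw [← h1, ← Finset.map_orderEmbOfFin_univ (active w) rfl, Finset.sum_map]
  rfl

end PredictivePrescription

open RealRAM PredictivePrescription in
theorem mainTheorem7 :
    -- one program and one polynomial bound for all problems
    ∃ (P : Prog) (C : ℝ) (m : ℕ),
      ∀ (d N : ℕ) (Y : Type*) (Z : Set (Vec d)) (c : Vec d → Y → ℝ)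
        (y : Fin N → Y) (w : Fin N → ℝ)
        (sep : Vec d → Option (Vec d)) (ev : Vec d → Y → ℝ) (sg : Vec d → Y → Vec d)
        (ε R r V : ℝ),
        (∀ i, 0 ≤ w i) →
        IsClosed Z → Convex ℝ Z → IsSeparationOracle Z sep →
        (∀ y', ConvexOn ℝ Z fun z => c z y') →
        IsEvaluationOracle Z c ev → IsSubgradientOracle Z c sg →
        0 < ε →
        -- the ball of radius `R` around the origin contains an optimal solution
        (∃ z₀ ∈ Z, ‖z₀‖ ≤ R ∧ ∀ z ∈ Z, objective c y w z₀ ≤ objective c y w z) →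
        -- the part of the feasible set in this ball contains some ball of radius `r`
        0 < r → (∃ a : Vec d, Metric.closedBall a r ⊆ Z ∩ Metric.closedBall 0 R) →
        -- and the objective varies by at most `V` there
        (∀ z ∈ Z ∩ Metric.closedBall 0 R, ∀ z' ∈ Z ∩ Metric.closedBall 0 R,
          objective c y w z - objective c y w z' ≤ V) →
        ∃ (s : State) (t q : ℕ),
          Exec (oracles sep ev sg y w) P (inputState d w ε R r V) s t q ∧
          IsEpsOptimal Z (objective c y w) ε (output d s) ∧
          (t : ℝ) ≤ C * (1 + effectiveSize w + d + Real.log (2 + R / r)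
            + Real.log (2 + V / ε)) ^ m ∧
          (q : ℝ) ≤ C * (1 + effectiveSize w + d + Real.log (2 + R / r)
            + Real.log (2 + V / ε)) ^ m := by
  refine ⟨simplexProg, simplexProg.size * 104 ^ simplexProg.depth, 4 * simplexProg.depth, ?_⟩
  intro d N Y Z c y w sep ev sg ε R r V hw _ hZ hsep hc hev hsg hε hmin hr hball hV
  have hR : 0 ≤ R := by
    obtain ⟨z₀, -, h, -⟩ := hmin
    exact (norm_nonneg z₀).trans h
  have hV0 : 0 ≤ V := by
    obtain ⟨a, ha⟩ := hball
    have hmem : a ∈ Z ∩ Metric.closedBall 0 R := ha (Metric.mem_closedBall_self hr.le)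
    simpa using hV a hmem a hmem
  have hobj : ∀ z, objective c y w z =
      ∑ j, w (activeIndex w j) * c z (y (activeIndex w j)) :=
    fun z => sum_mul_eq_sum_activeIndex hw fun i => c z (y i)
  have hF : ConvexOn ℝ Z (objective c y w) := by
    refine ⟨hZ, fun z hz z' hz' s t hs ht hst => ?_⟩
    simp only [objective, smul_eq_mul, Finset.mul_sum, ← Finset.sum_add_distrib]
    refine Finset.sum_le_sum fun i _ => ?_
    have := mul_le_mul_of_nonneg_left ((hc (y i)).2 hz hz' hs ht hst) (hw i)
    simp only [smul_eq_mul] at this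
    linarith
  obtain ⟨M, hM, hM', hMlog⟩ := exists_doublings d (div_nonneg hR hr.le) (div_nonneg hV0 hε.le)
  rw [← mul_div_assoc] at hM hM'
  obtain ⟨s, t, q, hexec, ht, hs⟩ := runs_simplexProg (O := oracles sep ev sg y w)
    (s := inputState d w ε R r V) (ω := fun j => w (activeIndex w j)) (F := objective c y w)
    rfl rfl rfl rfl rfl rfl rfl (fun j => by simp [inputState]) hsep
    (fun z hz => by
      rw [hobj]
      exact Finset.sum_congr rfl fun j _ => by
        change _ * ev z _ = _
        rw [hev z hz])
    (fun z hz z' hz' => by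
      rw [hobj, hobj, sum_inner, ← Finset.sum_add_distrib]
      refine Finset.sum_le_sum fun j _ => ?_
      rw [real_inner_smul_left, ← mul_add]
      exact mul_le_mul_of_nonneg_left (hsg z hz _ z' hz') (hw _))
    hF hε hmin hr hball hV hM hM'
  have hbound : (t : ℝ) ≤ simplexProg.size * 104 ^ simplexProg.depth *
      (1 + effectiveSize w + d + Real.log (2 + R / r) + Real.log (2 + V / ε)) ^
        (4 * simplexProg.depth) := by
    have hl1 : 0 ≤ Real.log (2 + R / r) :=
      Real.log_nonneg (by linarith [div_nonneg hR hr.le])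
    have hl2 : 0 ≤ Real.log (2 + V / ε) :=
      Real.log_nonneg (by linarith [div_nonneg hV0 hε.le])
    have hn0 : (0 : ℝ) ≤ effectiveSize w := Nat.cast_nonneg _
    exact (Nat.cast_le.2 ht).trans
      (cost_roundBound_le _ (by linarith) (by linarith))
  exact ⟨s, t, q, hexec, hs, hbound, (Nat.cast_le.2 hexec.calls_le_time).trans hbound⟩
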